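/- **Conventions.** On $\mathbb{R}^3$ let $\hat f(\xi)=\int e^{-ix\cdot\xi}f(x)\,dx$, let $m(D)$ be the Fourier multiplier with symbol $m(\xi)$, $\langle\xi\rangle=(1+|\xi|^2)^{1/2}$, and write $(e^{it\langle D\rangle}f)(x)$ as a function of $(t,x)\in\mathbb{R}\times\mathbb{R}^3$. For a function $u(t,x)$ let $\|u\|_{L^2_tL^\infty_x}=\big\|\,\|u(t,\cdot)\|_{L^\infty(\mathbb{R}^3)}\big\|_{L^2(\mathbb{R})}$. *Frames.* For $\lambda\in\mathbb{R}$ and a unit vector $\omega\in\mathbb{R}^3$ put $\Theta_{\lambda,\omega}=(1+\lambda^2)^{-1/2}(\lambda,\omega)$ and $\Theta^\perp_{\lambda,\omega}=(1+\lambda^2)^{-1/2}(-1,\lambda\omega)$. If $(\omega,\omega_2,\omega_3)$ is an orthonormal basis of $\mathbb{R}^3$, let $(t_{\lambda,\omega},x_{\lambda,\omega})\in\mathbb{R}\times\mathbb{R}^3$ be the coordinates on $\mathbb{R}^4$ with respect to the orthonormal basis $\Theta_{\lambda,\omega},\Theta^\perp_{\lambda,\omega},(0,\omega_2),(0,\omega_3)$,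 and let $\|u\|_{L^2_{t_{\lambda,\omega}}L^\infty_{x_{\lambda,\omega}}}$ be the mixed norm in these coordinates. *Dyadic localization.* Fix an even $\rho\in C_c^\infty(-2,2)$ with $0\le\rho\le1$ and $\rho=1$ on $[-1,1]$. For $k\in\mathbb{Z}$ let $\chi_k(\xi)=\rho(2^{-k}|\xi|)-\rho(2^{-k+1}|\xi|)$, $\tilde\chi_k=\chi_{k-1}+\chi_k+\chi_{k+1}$ and $\tilde A_k=\operatorname{supp}\tilde\chi_k$. *Angular localization.* Fix, for every integer $l\ge0$, a finite symmetric cover $\mathcal{K}_l$ of the unit sphere $\mathbb{S}^2$ by closed spherical caps $\kappa$ with centers $\omega(\kappa)$ and geodesic diameter $2^{-l}$, such that every point lies in at most $N$ caps of $\mathcal{K}_l$, with $N$ independent of $l$. Fix real functions $\eta_\kappa\ge0$, $\tilde\eta_\kappa$ ($\kappa\in\mathcal{K}_l$), smooth on $\mathbb{R}^3\setminus\{0\}$ and homogeneous of degree $0$, with $\sum_{\kappa\in\mathcal{K}_l}\eta_\kappa=1$ and $\tilde\eta_\kappa\eta_\kappa=\eta_\kappa$ on $\mathbb{R}^3\setminus\{0\}$,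 such that $\eta_\kappa(\xi)=0$ unless the angle between $\xi$ and $\omega(\kappa)$ is at most $2^{-l}$, $\tilde\eta_\kappa(\xi)=0$ unless this angle is at most $\tfrac M2 2^{-l}$ (for a fixed $M\ge2$), and, for $h=\eta_\kappa$ and $h=\tilde\eta_\kappa$, $$|\partial_\xi^\beta h(\xi)|\le C_\beta 2^{l|\beta|}|\xi|^{-|\beta|},\qquad |(\omega(\kappa)\cdot\nabla)^nh(\xi)|\le C_n|\xi|^{-n},\qquad \xi\neq0,$$ with constants independent of $l$ and $\kappa$. Put $\tilde P_\kappa=\tilde\eta_\kappa(D)$ and $\tilde A_{k,\kappa}=\operatorname{supp}(\tilde\eta_\kappa\tilde\chi_k)$. Finally let $\lambda(k)=(1+2^{-2k})^{-1/2}$ and $(t_{k,\kappa},x_{k,\kappa})=(t_{\lambda(k),\omega(\kappa)},x_{\lambda(k),\omega(\kappa)})$. **Theorem** (endpoint Strichartz estimates). All constants $C$ below depend only on the fixed choices above (and on $k_0$ in i)). i) For every $k_0\in\mathbb{Z}$ there is $C$ such that for all integers $k\le k_0$ and all $f\in L^2(\mathbb{R}^3)$ with $\operatorname{supp}\hat f\subset\tilde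 A_k$, $$\|e^{it\langle D\rangle}f\|_{L^2_tL^\infty_x}\le C\,2^{k/2}\|f\|_{L^2}.$$ ii) There is $C$ such that for all integers $k\ge1$, all $\kappa\in\mathcal{K}_k$ and all $f\in L^2(\mathbb{R}^3)$ with $\operatorname{supp}\hat f\subset\tilde A_{k,\kappa}$, $$2^{-k}\|e^{it\langle D\rangle}f\|_{L^2_tL^\infty_x}+\|e^{it\langle D\rangle}f\|_{L^2_{t_{k,\kappa}}L^\infty_{x_{k,\kappa}}}\le C\|f\|_{L^2}.$$ iii) There is $C$ such that for all integers $1\le l\le k$, all $\kappa_1\in\mathcal{K}_l$ and all $f\in L^2(\mathbb{R}^3)$ with $\operatorname{supp}\hat f\subset\tilde A_{k,\kappa_1}$, $$\sum_{\kappa\in\mathcal{K}_k}\|e^{it\langle D\rangle}\tilde P_\kappa f\|_{L^2_{t_{k,\kappa}}L^\infty_{x_{k,\kappa}}}\le C\,2^{k-l}\|f\|_{L^2}.$$ -/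

import Mathlib

open MeasureTheory FourierTransform
open scoped ENNReal NNReal

noncomputable section

namespace KleinGordon

/-- Physical and frequency space `ℝ³`. -/
abbrev E3 : Type := EuclideanSpace ℝ (Fin 3)

/-- The Hilbert space `L²(ℝ³; ℂ)`. -/
abbrev L2 : Type := Lp (α := E3) ℂ 2 (volume : Measure E3)

/-! ### Fourier multipliers and the half-wave propagator

The operator `m(D)` has symbol `m(ξ)` with respect to the characters `e^{i x·ξ}`.
Mathlib's Plancherel transform `𝓕` uses `e^{-2πi x·v}`, so that `ξ = 2πv`. -/

/-- The Fourier transform `f̂(ξ) = ∫ e^{-i x·ξ} f(x) dx` of `f ∈ L²`, as a function defined up to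
null sets. -/
def hat (f : L2) (ξ : E3) : ℂ := (𝓕 f : L2) ((2 * Real.pi)⁻¹ • ξ)

/-- `supp f̂ ⊆ A`, for a closed set `A`. -/
def FourierSupportedIn (f : L2) (A : Set E3) : Prop :=
  ∀ᵐ ξ : E3, ξ ∉ A → hat f ξ = 0

open Classical in
/-- The Fourier multiplier `m(D)` on its natural domain in `L²` (and `0` outside the domain; for
bounded measurable `m` the domain is all of `L²`). -/
def multiplier (m : E3 → ℂ) (f : L2) : L2 :=
  if h : MemLp (fun v : E3 => m ((2 * Real.pi) • v) * (𝓕 f : L2) v) 2 volume then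
    𝓕⁻ (h.toLp _ : L2)
  else 0

/-- The Japanese bracket `⟨ξ⟩ = (1 + |ξ|²)^{1/2}`. -/
def bracket (ξ : E3) : ℝ := Real.sqrt (1 + ‖ξ‖ ^ 2)

/-- The symbol of `e^{it⟨D⟩}`. -/
def flowSymbol (t : ℝ) (ξ : E3) : ℂ := Complex.exp (Complex.I * ((t * bracket ξ : ℝ) : ℂ))

/-- The propagator `e^{it⟨D⟩}` on `L²`. -/
def freeFlow (t : ℝ) (f : L2) : L2 := multiplier (flowSymbol t) f

/-- The space-time function `(t, x) ↦ (e^{it⟨D⟩} f)(x)` for `f ∈ L²` whose Fourier transform is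
integrable (in particular, if it has bounded support):
`(2π)⁻³ ∫ e^{i x·ξ} e^{it⟨ξ⟩} f̂(ξ) dξ`. The lemma `freeWave_ae_eq_freeFlow` below shows that it
represents `freeFlow t f` for every `t`. -/
def freeWave (f : L2) (p : ℝ × E3) : ℂ :=
  (((2 * Real.pi) ^ 3)⁻¹ : ℝ) •
    ∫ ξ : E3, Complex.exp (Complex.I * ((inner ℝ p.2 ξ : ℝ) : ℂ)) * flowSymbol p.1 ξ * hat f ξ

/-! ### Mixed norms and adapted frames -/

/-- `‖u‖_{L^p_t L^q_x}` for `u` a function of `(t, x) ∈ ℝ × ℝ³`. -/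
def mixedNorm (p q : ℝ≥0∞) (u : ℝ × E3 → ℂ) : ℝ≥0∞ :=
  eLpNorm (fun t : ℝ => eLpNorm (fun x : E3 => u (t, x)) q volume) p volume

/-- The direction `Θ_{λ,ω} = (1 + λ²)^{-1/2} (λ, ω)`. -/
def theta (lam : ℝ) (ω : E3) : ℝ × E3 := (Real.sqrt (1 + lam ^ 2))⁻¹ • (lam, ω)

/-- The direction `Θ^⊥_{λ,ω} = (1 + λ²)^{-1/2} (-1, λω)`. -/
def thetaPerp (lam : ℝ) (ω : E3) : ℝ × E3 := (Real.sqrt (1 + lam ^ 2))⁻¹ • (-1, lam • ω)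

/-- The space-time point with coordinates `t_{λ,ω} = q.1` and `x_{λ,ω} = q.2` with respect to the
orthonormal basis `Θ_{λ,ω}, Θ^⊥_{λ,ω}, (0, ω₂), (0, ω₃)`, where `(ω, ω₂, ω₃)` is the orthonormal
basis `b` of `ℝ³`. -/
def framePoint (lam : ℝ) (b : OrthonormalBasis (Fin 3) ℝ E3) (q : ℝ × E3) : ℝ × E3 :=
  q.1 • theta lam (b 0) + q.2 0 • thetaPerp lam (b 0)
    + q.2 1 • ((0 : ℝ), b 1) + q.2 2 • ((0 : ℝ), b 2)

/-- `‖u‖_{L^p_{t_{λ,ω}} L^q_{x_{λ,ω}}}`, with `ω = b 0`. -/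
def frameNorm (p q : ℝ≥0∞) (lam : ℝ) (b : OrthonormalBasis (Fin 3) ℝ E3) (u : ℝ × E3 → ℂ) : ℝ≥0∞ :=
  mixedNorm p q (fun z => u (framePoint lam b z))

/-- `λ(k) = (1 + 2^{-2k})^{-1/2}`. -/
def lamK (k : ℕ) : ℝ := (Real.sqrt (1 + ((2 : ℝ) ^ (2 * k))⁻¹))⁻¹

/-! ### Dyadic localization -/

/-- The admissible cutoffs `ρ ∈ C_c^∞(-2, 2)`: even, `0 ≤ ρ ≤ 1`, and `ρ = 1` on `[-1, 1]`. -/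
structure IsCutoff (ρ : ℝ → ℝ) : Prop where
  contDiff : ContDiff ℝ (⊤ : ℕ∞) ρ
  tsupport_subset : tsupport ρ ⊆ Set.Ioo (-2) 2
  even : ∀ s, ρ (-s) = ρ s
  eq_one : ∀ s, |s| ≤ 1 → ρ s = 1
  nonneg : ∀ s, 0 ≤ ρ s
  le_one : ∀ s, ρ s ≤ 1

/-- `χ_k(ξ) = ρ(2^{-k}|ξ|) - ρ(2^{-k+1}|ξ|)`. -/
def chi (ρ : ℝ → ℝ) (k : ℤ) (ξ : E3) : ℝ :=
  ρ ((2 : ℝ) ^ (-k) * ‖ξ‖) - ρ ((2 : ℝ) ^ (-k + 1) * ‖ξ‖)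

/-- `χ̃_k = χ_{k-1} + χ_k + χ_{k+1}`. -/
def chiTilde (ρ : ℝ → ℝ) (k : ℤ) (ξ : E3) : ℝ :=
  chi ρ (k - 1) ξ + chi ρ k ξ + chi ρ (k + 1) ξ

/-- `Ã_k = supp χ̃_k`. -/
def annulus (ρ : ℝ → ℝ) (k : ℤ) : Set E3 := tsupport (chiTilde ρ k)

/-! ### Angular localization -/

/-- The closed spherical cap with center `ω ∈ 𝕊²` and (geodesic) diameter `2^{-l}`. -/
def cap (l : ℕ) (ω : E3) : Set E3 :=
  {y | ‖y‖ = 1 ∧ InnerProductGeometry.angle ω y ≤ ((2 : ℝ) ^ l)⁻¹ / 2}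

/-- `h` is a smooth angular cutoff on `ℝ³ ∖ {0}`, homogeneous of degree zero, supported in the cone
over the cap with center `ω` that is dilated by the factor `M` from the cap of diameter `2^{-l}`,
with the natural bounds (constants `C`) for all its derivatives and for the derivatives
`(ω·∇)^n`. -/
structure IsAngularCutoff (C : ℕ → ℝ) (M : ℝ) (l : ℕ) (ω : E3) (h : E3 → ℝ) : Prop where
  contDiffOn : ContDiffOn ℝ (⊤ : ℕ∞) h {0}ᶜ
  homogeneous : ∀ c : ℝ, 0 < c → ∀ ξ : E3, ξ ≠ 0 → h (c • ξ) = h ξ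
  support : ∀ ξ : E3, ξ ≠ 0 → h ξ ≠ 0 →
    InnerProductGeometry.angle ω ξ ≤ M * (((2 : ℝ) ^ l)⁻¹ / 2)
  deriv_bound : ∀ (n : ℕ) (ξ : E3), ξ ≠ 0 →
    ‖iteratedFDeriv ℝ n h ξ‖ ≤ C n * 2 ^ (l * n) * (‖ξ‖ ^ n)⁻¹
  radial_bound : ∀ (n : ℕ) (ξ : E3), ξ ≠ 0 →
    |iteratedFDeriv ℝ n h ξ (fun _ => ω)| ≤ C n * (‖ξ‖ ^ n)⁻¹

/-- A choice, for every `l`, of a symmetric, uniformly finitely overlapping cover `𝒦_l` of `𝕊²` by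
caps of diameter `2^{-l}` (a cap is recorded by its center), of a subordinate partition of unity
`η_κ` on `ℝ³ ∖ {0}` with `η_κ` supported in the double cone `2Γ_κ`, and of similar functions `η̃_κ`
with bigger support and `η̃_κ η_κ = η_κ`. All constants are uniform in `l` and `κ`. -/
structure AngularDecomposition where
  /-- the centers of the caps in `𝒦_l` -/
  centers : ℕ → Finset E3
  norm_center : ∀ l, ∀ ω ∈ centers l, ‖ω‖ = 1
  symmetric : ∀ l, ∀ ω ∈ centers l, -ω ∈ centers l
  cover : ∀ (l : ℕ) (y : E3), ‖y‖ = 1 → ∃ ω ∈ centers l, y ∈ cap l ω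
  finite_overlap : ∃ N : ℕ, ∀ (l : ℕ) (y : E3),
    {ω : E3 | ω ∈ centers l ∧ y ∈ cap l ω}.ncard ≤ N
  /-- `eta l ω` is `η_κ` for the cap `κ ∈ 𝒦_l` with center `ω` -/
  eta : ℕ → E3 → E3 → ℝ
  /-- `etaTilde l ω` is `η̃_κ` for the cap `κ ∈ 𝒦_l` with center `ω` -/
  etaTilde : ℕ → E3 → E3 → ℝ
  /-- the constants in the derivative bounds -/
  C : ℕ → ℝ
  /-- the dilation factor for the supports of the `η̃_κ` -/
  M : ℝ
  two_le_M : 2 ≤ M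
  eta_cutoff : ∀ l, ∀ ω ∈ centers l, IsAngularCutoff C 2 l ω (eta l ω)
  eta_nonneg : ∀ l, ∀ ω ∈ centers l, ∀ ξ : E3, ξ ≠ 0 → 0 ≤ eta l ω ξ
  sum_eta : ∀ (l : ℕ) (ξ : E3), ξ ≠ 0 → ∑ ω ∈ centers l, eta l ω ξ = 1
  etaTilde_cutoff : ∀ l, ∀ ω ∈ centers l, IsAngularCutoff C M l ω (etaTilde l ω)
  etaTilde_mul_eta : ∀ l, ∀ ω ∈ centers l, ∀ ξ : E3, ξ ≠ 0 →
    etaTilde l ω ξ * eta l ω ξ = eta l ω ξ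

namespace AngularDecomposition

/-- `Ã_{k,κ} = supp (η̃_κ χ̃_k)` for `κ ∈ 𝒦_l` with center `ω`. -/
def sector (𝒦 : AngularDecomposition) (ρ : ℝ → ℝ) (k : ℤ) (l : ℕ) (ω : E3) : Set E3 :=
  tsupport (fun ξ => 𝒦.etaTilde l ω ξ * chiTilde ρ k ξ)

/-- `P̃_κ = η̃_κ(D)` for `κ ∈ 𝒦_l` with center `ω`. -/
def proj (𝒦 : AngularDecomposition) (l : ℕ) (ω : E3) (f : L2) : L2 :=
  multiplier (fun ξ => (𝒦.etaTilde l ω ξ : ℂ)) f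

end AngularDecomposition

/-! ### The pointwise formula represents the propagator -/

lemma continuous_flowSymbol (t : ℝ) : Continuous (flowSymbol t) := by
  unfold flowSymbol bracket
  fun_prop

lemma norm_flowSymbol (t : ℝ) (ξ : E3) : ‖flowSymbol t ξ‖ = 1 := by
  unfold flowSymbol
  rw [mul_comm]
  exact Complex.norm_exp_ofReal_mul_I _

lemma memLp_flow (t : ℝ) (f : L2) :
    MemLp (fun v : E3 => flowSymbol t ((2 * Real.pi) • v) * (𝓕 f : L2) v) 2 volume := by
  refine MemLp.of_le (Lp.memLp (𝓕 f : L2)) ?_ (Filter.Eventually.of_forall fun v => ?_)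
  · exact (((continuous_flowSymbol t).comp (continuous_const_smul _)).aestronglyMeasurable).mul
      (Lp.aestronglyMeasurable (𝓕 f : L2))
  · rw [norm_mul, norm_flowSymbol, one_mul]

/-- On `L¹ ∩ L²` the inverse Plancherel transform is given by the Fourier integral. -/
lemma fourierInv_ae_eq (g : L2) (hg : Integrable (g : E3 → ℂ)) :
    ((𝓕⁻ g : L2) : E3 → ℂ) =ᵐ[volume] 𝓕⁻ (g : E3 → ℂ) := by
  refine ae_eq_of_integral_contDiff_smul_eq
    ((Lp.memLp (𝓕⁻ g : L2)).locallyIntegrable (by norm_num)) ?_ ?_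
  · have hc : Continuous (𝓕⁻ (g : E3 → ℂ)) :=
      VectorFourier.fourierIntegral_continuous Real.continuous_fourierChar
        (L := -innerₗ E3) ((continuous_inner (𝕜 := ℝ) (E := E3)).neg) hg
    exact hc.locallyIntegrable
  · intro φ hφ hφc
    have h₁ : HasCompactSupport (fun x => (φ x : ℂ)) := hφc.comp_left (g := Complex.ofReal) rfl
    have h₂ : ContDiff ℝ (⊤ : ℕ∞) (fun x => (φ x : ℂ)) := Complex.ofRealCLM.contDiff.comp hφ
    set Φ : SchwartzMap E3 ℂ := h₁.toSchwartzMap h₂ with hΦ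
    have key := congrArg (fun T => T Φ) (Lp.fourierInv_toTemperedDistribution_eq g)
    simp only [TemperedDistribution.fourierInv_apply, Lp.toTemperedDistribution_apply] at key
    have h3 := VectorFourier.integral_fourierIntegral_smul_eq_flip (μ := volume) (ν := volume)
      (f := (Φ : E3 → ℂ)) (g := (g : E3 → ℂ)) Real.continuous_fourierChar
      (L := -innerₗ E3) ((continuous_inner (𝕜 := ℝ) (E := E3)).neg)
      Φ.integrable hg
    have hflip : (-innerₗ E3).flip = -innerₗ E3 := by
      ext x y
      simp [real_inner_comm]
    rw [hflip] at h3
    rw [SchwartzMap.fourierInv_coe] at key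
    have e1 : ∀ x, Φ x = (φ x : ℂ) := fun x => rfl
    calc ∫ x, φ x • (𝓕⁻ g : L2) x = ∫ x, Φ x • (𝓕⁻ g : L2) x := by
          refine integral_congr_ae (Filter.Eventually.of_forall fun x => ?_)
          simp [e1]
      _ = _ := key.symm
      _ = _ := h3
      _ = _ := by
          refine integral_congr_ae (Filter.Eventually.of_forall fun x => ?_)
          simp only [e1, Complex.real_smul, smul_eq_mul]
          rfl

lemma integrable_of_fourierSupportedIn {f : L2} {A : Set E3} (hA : Bornology.IsBounded A)
    (hf : FourierSupportedIn f A) : Integrable ((𝓕 f : L2) : E3 → ℂ) := by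
  obtain ⟨R, hR⟩ := hA.subset_closedBall (0 : E3)
  have h2 : (2 * Real.pi) ≠ 0 := by positivity
  have hq : ∀ᵐ v : E3, v ∉ Metric.closedBall (0 : E3) (R / (2 * Real.pi)) → (𝓕 f : L2) v = 0 := by
    have hqm : Measure.QuasiMeasurePreserving (fun v : E3 => (2 * Real.pi) • v) volume volume := by
      refine ⟨measurable_const_smul _, ?_⟩
      rw [Measure.map_addHaar_smul _ h2]
      exact Measure.smul_absolutelyContinuous
    have := hqm.ae hf
    filter_upwards [this] with v hv hvn
    have hv' : (2 * Real.pi) • v ∉ A → hat f ((2 * Real.pi) • v) = 0 := hv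
    rw [hat, inv_smul_smul₀ h2] at hv'
    refine hv' fun hmem => hvn ?_
    have := hR hmem
    rw [mem_closedBall_zero_iff, norm_smul, Real.norm_of_nonneg (by positivity)] at this
    rw [mem_closedBall_zero_iff, le_div_iff₀ (by positivity)]
    linarith
  have hI : IntegrableOn ((𝓕 f : L2) : E3 → ℂ) (Metric.closedBall (0 : E3) (R / (2 * Real.pi))) :=
    ((Lp.memLp (𝓕 f : L2)).locallyIntegrable (by norm_num)).integrableOn_isCompact
      (isCompact_closedBall _ _)
  exact hI.integrable_of_ae_notMem_eq_zero hq

/-- For data with bounded frequency support, `freeWave f (t, ·)` is `e^{it⟨D⟩} f` for every `t`. -/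
theorem freeWave_ae_eq_freeFlow {f : L2} {A : Set E3} (hA : Bornology.IsBounded A)
    (hf : FourierSupportedIn f A) (t : ℝ) :
    (fun x => freeWave f (t, x)) =ᵐ[volume] (freeFlow t f : E3 → ℂ) := by
  have hint := integrable_of_fourierSupportedIn hA hf
  have h2 : (2 * Real.pi) ≠ 0 := by positivity
  have hm := memLp_flow t f
  rw [freeFlow, multiplier, dif_pos hm]
  have hg : Integrable (fun v : E3 => flowSymbol t ((2 * Real.pi) • v) * (𝓕 f : L2) v) := by
    refine hint.mono hm.aestronglyMeasurable (Filter.Eventually.of_forall fun v => ?_)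
    rw [norm_mul, norm_flowSymbol, one_mul]
  have h := fourierInv_ae_eq (hm.toLp _) ((integrable_congr hm.coeFn_toLp).2 hg)
  refine Filter.EventuallyEq.trans (Filter.Eventually.of_forall fun x => ?_) h.symm
  rw [Real.fourierInv_congr_ae hm.coeFn_toLp, Real.fourierInv_eq']
  have hc := Measure.integral_comp_smul (volume : Measure E3) (fun ξ : E3 =>
    Complex.exp (Complex.I * ((inner ℝ x ξ : ℝ) : ℂ)) * flowSymbol t ξ * hat f ξ) (2 * Real.pi)
  rw [finrank_euclideanSpace_fin, abs_of_nonneg (by positivity)] at hc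
  unfold freeWave
  simp only
  rw [← hc]
  refine integral_congr_ae (Filter.Eventually.of_forall fun v => ?_)
  simp only [hat, inv_smul_smul₀ h2, inner_smul_right, smul_eq_mul, real_inner_comm x v]
  rw [mul_assoc, mul_comm Complex.I]

end KleinGordon

end

open KleinGordon

/-!
All three estimates are `TT*` estimates. For a measurable choice `t ↦ X(t)` of points, the map `g
↦ ∫ e^{i(X(t)·ξ + t⟨ξ⟩)} g(ξ) dξ` is bounded from `L²` to `L²_t` as soon as the kernel `K(t, x) =
∫ e^{i(x·ξ + t⟨ξ⟩)} w(ξ) dξ` is dominated by an integrable function of `t` alone; here `w` may be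
any integrable weight which is bounded below on the frequency support of the data
(`integral_norm_synth_sq_le`). Choosing `X(t)` where `|u(t, ·)|` is nearly maximal gives the bound
for `L²_t L^∞_x` (`mixedNorm_synth_le`), and the same argument works in every linear system of
space-time coordinates.

The freedom in `w` makes the kernels explicit. For `w = e^{-β(⟨ξ⟩ - 1)}/⟨ξ⟩` the integral over the
plane orthogonal to `x` is that of an exact derivative, so that with `z = β - it` the kernel has
absolute value `2π |z|⁻¹ |∫_ℝ e^{i|x|r - z(⟨r⟩ - 1)} dr|` (`kernel_eq`). The factor `|z|⁻¹` is the
decay from the two angular directions; van der Corput's second derivative test gives another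
`|t|^{-1/2}` (`norm_integral_osc_le`). Hence `|K| ≲ (β + |t|)^{-3/2}`, whose integral is
`O(β^{-1/2})`. At low frequencies `β = 2^{-2k}` yields the factor `2^{k/2}` after taking the
square root (`low_frequency`).

At high frequencies the sector of length `2^k` and width `1` around `2^k ω` is, up to constants,
the image of a ball of radius `O(1)` under the Lorentz boost with `sinh` of the rapidity equal to
`2^k`. Boosting the weight with `β = 1` transforms the kernel into the kernel at unit frequency,
evaluated at the boosted point `(t', x')` (`norm_integral_wave_sectorWeight`), which is `O((1 +
|t'| + |x'|)^{-3/2})`. Now `2^{-k}|t| ≲ |t'| + |x'|`, and the component of `x'` along `ω` is the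
frame time `t_{k,κ}` times a factor of size at least `2^k` (`boosted_framePoint`). Integrating the
majorants `(1 + 2^{-k}|t|)^{-3/2}` and `(1 + 2^k |t_{k,κ}|)^{-3/2}` gives both bounds for one
sector (`sector_estimates`).

For the sum over caps, only `O(4^{k-l})` caps of diameter `2^{-k}` meet a given sector of angle
`2^{-l}` (`exists_card_centers_le`), and the projections `P̃_κ` are almost orthogonal
(`exists_sum_norm_proj_sq_le`); the Cauchy–Schwarz inequality gives the factor `2^{k-l}`.
-/

namespace KleinGordon

/-! ### Oscillatory integrals on the line -/

/-- The Japanese bracket `⟨r⟩ = (1 + r²)^{1/2}` on the line. -/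
noncomputable def bra (r : ℝ) : ℝ := Real.sqrt (1 + r ^ 2)

lemma bra_sq (r : ℝ) : bra r ^ 2 = 1 + r ^ 2 := Real.sq_sqrt (by positivity)

lemma one_le_bra (r : ℝ) : 1 ≤ bra r := by
  rw [bra, Real.one_le_sqrt]; nlinarith [sq_nonneg r]

lemma bra_pos (r : ℝ) : 0 < bra r := by linarith [one_le_bra r]

lemma abs_le_bra (r : ℝ) : |r| ≤ bra r :=
  Real.abs_le_sqrt (by linarith)

lemma bra_le (r : ℝ) : bra r ≤ 1 + |r| := by
  refine (Real.sqrt_le_left (by positivity)).2 ?_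
  nlinarith [abs_nonneg r, sq_abs r]

lemma bra_abs (r : ℝ) : bra |r| = bra r := by simp [bra]

lemma hasDerivAt_bra (r : ℝ) : HasDerivAt bra (r / bra r) r := by
  have h : HasDerivAt (fun r : ℝ => 1 + r ^ 2) (2 * r) r := by
    simpa using (hasDerivAt_pow 2 r).const_add 1
  have h2 := h.sqrt (by positivity)
  rwa [mul_div_mul_left _ _ two_ne_zero] at h2

@[fun_prop]
lemma continuous_bra : Continuous bra := by unfold bra; fun_prop

lemma hasDerivAt_velocity (r : ℝ) : HasDerivAt (fun r => r / bra r) ((bra r ^ 3)⁻¹) r := by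
  have h := (hasDerivAt_id r).div (hasDerivAt_bra r) (bra_pos r).ne'
  have e : (1 * bra r - id r * (r / bra r)) / bra r ^ 2 = (bra r ^ 3)⁻¹ := by
    have := bra_pos r
    have h2 := bra_sq r
    simp only [id]
    field_simp
    linarith
  rw [e] at h
  exact h

lemma abs_velocity_le (r : ℝ) : |r / bra r| ≤ 1 := by
  rw [abs_div, abs_of_pos (bra_pos r), div_le_one (bra_pos r)]
  exact abs_le_bra r

/-- The amplitude `e^{-β(⟨r⟩ - 1)}`. -/
noncomputable def amp (β r : ℝ) : ℝ := Real.exp (-(β * (bra r - 1)))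

lemma amp_pos (β r : ℝ) : 0 < amp β r := Real.exp_pos _

lemma amp_le_one {β : ℝ} (hβ : 0 ≤ β) (r : ℝ) : amp β r ≤ 1 := by
  rw [amp, Real.exp_le_one_iff, neg_nonpos]
  exact mul_nonneg hβ (by linarith [one_le_bra r])

@[fun_prop]
lemma continuous_amp (β : ℝ) : Continuous (amp β) := by unfold amp; fun_prop

/-- Gaussian decay at scale `β^{-1/2}`, and exponential decay further out, in one integrable bound. -/
lemma amp_le {b β : ℝ} (hb : 0 < b) (hβ : b ≤ β) (r : ℝ) :
    amp β r ≤ (3 + 18 / b) * (1 + β * r ^ 2)⁻¹ := by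
  have hβ0 : 0 < β := hb.trans_le hβ
  set y := β * (bra r - 1) with hy
  have hE := one_le_bra r
  have hy0 : 0 ≤ y := mul_nonneg hβ0.le (by linarith)
  have hyr : y * (1 + bra r) = β * r ^ 2 := by
    rw [hy]; nlinarith [bra_sq r]
  have h1 : amp β r ≤ (1 + y + y ^ 2 / 2)⁻¹ := by
    rw [amp, Real.exp_neg]
    exact inv_anti₀ (by positivity) (Real.quadratic_le_exp_of_nonneg hy0)
  refine h1.trans ?_
  rw [← div_eq_mul_inv, inv_eq_one_div, div_le_div_iff₀ (by positivity) (by positivity), one_mul]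
  have h18 : 0 ≤ 18 / b := by positivity
  have key : β * r ^ 2 ≤ 3 * y + 18 / b * (y ^ 2 / 2) := by
    rcases le_total (|r|) 1 with hr | hr
    · have : bra r ≤ 2 := (bra_le r).trans (by linarith)
      have : β * r ^ 2 ≤ 3 * y := by nlinarith
      have h0 : 0 ≤ 18 / b * (y ^ 2 / 2) := by positivity
      linarith
    · have hE3 : 1 + bra r ≤ 3 * |r| := by linarith [bra_le r]
      have h3 : β * |r| ≤ 3 * y := by
        have : β * |r| * |r| ≤ 3 * y * |r| := by
          calc β * |r| * |r| = β * r ^ 2 := by rw [mul_assoc, ← sq, sq_abs]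
            _ = y * (1 + bra r) := hyr.symm
            _ ≤ y * (3 * |r|) := by gcongr
            _ = _ := by ring
        exact le_of_mul_le_mul_right this (by linarith)
      have h4 : β ^ 2 * r ^ 2 ≤ 9 * y ^ 2 := by
        calc β ^ 2 * r ^ 2 = (β * |r|) ^ 2 := by rw [mul_pow, sq_abs]
          _ ≤ (3 * y) ^ 2 := by gcongr
          _ = _ := by ring
      have h5 : b * (β * r ^ 2) ≤ 9 * y ^ 2 := by
        refine le_trans ?_ h4
        have : 0 ≤ β * r ^ 2 := by positivity
        nlinarith
      have h6 : β * r ^ 2 ≤ 18 / b * (y ^ 2 / 2) := by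
        rw [div_mul_div_comm, le_div_iff₀ (by positivity)]
        linarith
      linarith
  nlinarith [sq_nonneg y]

lemma integrable_inv_one_add_mul_sq {β : ℝ} (hβ : 0 < β) :
    Integrable (fun r : ℝ => (1 + β * r ^ 2)⁻¹) := by
  have h := integrable_inv_one_add_sq.comp_mul_left' (Real.sqrt_pos.2 hβ).ne'
  refine h.congr (Filter.Eventually.of_forall fun r => ?_)
  simp only [mul_pow, Real.sq_sqrt hβ.le]

lemma integral_inv_one_add_mul_sq {β : ℝ} (hβ : 0 < β) :
    ∫ r : ℝ, (1 + β * r ^ 2)⁻¹ = Real.pi / Real.sqrt β := by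
  have h := Measure.integral_comp_mul_left (fun x : ℝ => (1 + x ^ 2)⁻¹) (Real.sqrt β)
  simp only [mul_pow, Real.sq_sqrt hβ.le] at h
  rw [h, integral_univ_inv_one_add_sq, abs_of_pos (inv_pos.2 (Real.sqrt_pos.2 hβ)), smul_eq_mul]
  field_simp

lemma integrable_amp {β : ℝ} (hβ : 0 < β) : Integrable (amp β) := by
  refine ((integrable_inv_one_add_mul_sq hβ).const_mul (3 + 18 / β)).mono'
    (continuous_amp β).aestronglyMeasurable (Filter.Eventually.of_forall fun r => ?_)
  rw [Real.norm_of_nonneg (amp_pos β r).le]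
  exact amp_le hβ le_rfl r

lemma integral_amp_le {b β : ℝ} (hb : 0 < b) (hβ : b ≤ β) :
    ∫ r, amp β r ≤ (3 + 18 / b) * Real.pi / Real.sqrt β := by
  have hβ0 : 0 < β := hb.trans_le hβ
  refine (integral_mono (integrable_amp hβ0) ((integrable_inv_one_add_mul_sq hβ0).const_mul _)
    (amp_le hb hβ)).trans_eq ?_
  rw [integral_const_mul, integral_inv_one_add_mul_sq hβ0, mul_div_assoc]

/-- The amplitude compensates the degeneracy `⟨r⟩'' = ⟨r⟩⁻³` of the phase at infinity. -/
lemma amp_mul_bra_cube_le {b β : ℝ} (hb : 0 < b) (hβ : b ≤ β) (r : ℝ) :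
    amp β r * bra r ^ 3 ≤ ((min (b / 3) 1) ^ 3)⁻¹ := by
  set c := min (b / 3) 1 with hc
  have hc0 : 0 < c := lt_min (by positivity) one_pos
  have hE := one_le_bra r
  have h1 : c * bra r ≤ Real.exp (c * (bra r - 1)) := by
    have := Real.add_one_le_exp (c * (bra r - 1))
    have h1 : c ≤ 1 := min_le_right _ _
    linarith
  have h2 : c ^ 3 * bra r ^ 3 ≤ Real.exp (β * (bra r - 1)) := by
    calc c ^ 3 * bra r ^ 3 = (c * bra r) ^ 3 := by ring
      _ ≤ Real.exp (c * (bra r - 1)) ^ 3 := by gcongr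
      _ = Real.exp (3 * c * (bra r - 1)) := by rw [← Real.exp_nat_mul]; congr 1; push_cast; ring
      _ ≤ _ := by
        have : c ≤ b / 3 := min_le_left _ _
        gcongr
        linarith
  rw [amp, Real.exp_neg, inv_mul_eq_div, div_le_iff₀ (Real.exp_pos _), inv_mul_eq_div,
    le_div_iff₀ (by positivity)]
  linarith

lemma hasDerivAt_amp (β r : ℝ) : HasDerivAt (amp β) (-(β * (r / bra r)) * amp β r) r := by
  have := (((hasDerivAt_bra r).sub_const 1).const_mul β).neg.exp
  rw [mul_comm]
  exact this

lemma integrable_velocity_mul_amp {β : ℝ} (hβ : 0 < β) :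
    Integrable (fun r => β * (|r| / bra r) * amp β r) := by
  refine ((integrable_amp hβ).const_mul β).mono' (by
    refine Continuous.aestronglyMeasurable ?_
    have := fun r => (bra_pos r).ne'
    fun_prop (disch := assumption)) (Filter.Eventually.of_forall fun r => ?_)
  have h1 : 0 ≤ |r| / bra r := div_nonneg (abs_nonneg _) (bra_pos r).le
  have h2 : |r| / bra r ≤ 1 := (div_le_one (bra_pos r)).2 (abs_le_bra r)
  rw [Real.norm_of_nonneg (by have := (amp_pos β r).le; positivity)]
  have := amp_pos β r
  gcongr
  nlinarith

lemma tendsto_bra_atTop : Filter.Tendsto bra Filter.atTop Filter.atTop :=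
  Filter.tendsto_atTop_mono (fun r => (le_abs_self r).trans (abs_le_bra r)) Filter.tendsto_id

/-- The total variation of the amplitude. -/
lemma integral_velocity_mul_amp {β : ℝ} (hβ : 0 < β) :
    ∫ r, β * (|r| / bra r) * amp β r = 2 := by
  have h := integral_comp_abs (f := fun r => β * (r / bra r) * amp β r)
  simp only [bra_abs] at h
  have h' : ∀ r, amp β |r| = amp β r := fun r => by rw [amp, bra_abs, amp]
  simp only [h'] at h
  rw [h]
  have ht : Filter.Tendsto (fun r => - amp β r) Filter.atTop (nhds 0) := by
    rw [← neg_zero]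
    refine Filter.Tendsto.neg (Real.tendsto_exp_atBot.comp ?_)
    refine Filter.tendsto_neg_atTop_atBot.comp (Filter.Tendsto.const_mul_atTop hβ ?_)
    exact Filter.tendsto_atTop_add_const_right _ _ tendsto_bra_atTop
  have := integral_Ioi_of_hasDerivAt_of_tendsto' (a := 0) (f := fun r => - amp β r)
    (f' := fun r => β * (r / bra r) * amp β r) (m := 0)
    (fun r _ => by
      have := (hasDerivAt_amp β r).neg
      rw [neg_mul, neg_neg] at this
      exact this)
    (by
      refine (integrable_velocity_mul_amp hβ).integrableOn.congr_fun (fun r hr => ?_)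
        measurableSet_Ioi
      simp only [abs_of_pos (Set.mem_Ioi.1 hr)])
    ht
  rw [this]
  simp [amp, bra]

/-- The integrand `e^{iρr - z(⟨r⟩ - 1)}`; the amplitude is governed by `Re z`, the time is
`-Im z`. -/
noncomputable def osc (z : ℂ) (ρ r : ℝ) : ℂ :=
  Complex.exp (Complex.I * ((ρ * r : ℝ) : ℂ) - z * ((bra r - 1 : ℝ) : ℂ))

/-- The derivative `ρ - (Im z) r/⟨r⟩` of the phase of `osc z ρ`. -/
noncomputable def phaseDeriv (z : ℂ) (ρ r : ℝ) : ℝ := ρ - z.im * (r / bra r)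

lemma norm_osc (z : ℂ) (ρ r : ℝ) : ‖osc z ρ r‖ = amp z.re r := by
  rw [osc, Complex.norm_exp, amp]
  congr 1
  simp [Complex.mul_re]

@[fun_prop]
lemma continuous_osc (z : ℂ) (ρ : ℝ) : Continuous (osc z ρ) := by unfold osc; fun_prop

@[fun_prop]
lemma continuous_velocity : Continuous (fun r : ℝ => r / bra r) :=
  continuous_id.div continuous_bra fun r => (bra_pos r).ne'

@[fun_prop]
lemma continuous_phaseDeriv (z : ℂ) (ρ : ℝ) : Continuous (phaseDeriv z ρ) := by
  unfold phaseDeriv; fun_prop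

lemma integrable_osc {z : ℂ} (hz : 0 < z.re) (ρ : ℝ) : Integrable (osc z ρ) :=
  (integrable_amp hz).mono' (continuous_osc z ρ).aestronglyMeasurable
    (Filter.Eventually.of_forall fun r => (norm_osc z ρ r).le)

lemma hasDerivAt_osc (z : ℂ) (ρ r : ℝ) : HasDerivAt (osc z ρ)
    ((Complex.I * (phaseDeriv z ρ r : ℂ) - ((z.re * (r / bra r) : ℝ) : ℂ)) * osc z ρ r) r := by
  have h1 : HasDerivAt (fun r : ℝ => ((ρ * r : ℝ) : ℂ)) (ρ : ℂ) r := by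
    have := ((hasDerivAt_id r).const_mul ρ).ofReal_comp
    simpa using this
  have h2 : HasDerivAt (fun r : ℝ => ((bra r - 1 : ℝ) : ℂ)) ((r / bra r : ℝ) : ℂ) r :=
    ((hasDerivAt_bra r).sub_const 1).ofReal_comp
  have h := ((h1.const_mul Complex.I).sub (h2.const_mul z)).cexp
  have e : Complex.I * (phaseDeriv z ρ r : ℂ) - ((z.re * (r / bra r) : ℝ) : ℂ)
      = Complex.I * (ρ : ℂ) - z * ((r / bra r : ℝ) : ℂ) := by
    conv_rhs => rw [← Complex.re_add_im z]
    simp only [phaseDeriv]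
    push_cast
    ring
  rw [e, mul_comm]
  exact h

lemma hasDerivAt_phaseDeriv (z : ℂ) (ρ r : ℝ) :
    HasDerivAt (phaseDeriv z ρ) (-(z.im * (bra r ^ 3)⁻¹)) r :=
  ((hasDerivAt_velocity r).const_mul z.im).const_sub ρ

/-- The size of the set where a monotone phase derivative `p` is at most `√N`, in the smoothed form
`∫ |p'| / (p² + N) ≤ π / √N`. -/
lemma integral_phaseDeriv_le (z : ℂ) (ρ : ℝ) {N : ℝ} (hN : 0 < N) :
    Integrable (fun r => |z.im| * (bra r ^ 3)⁻¹ / (phaseDeriv z ρ r ^ 2 + N)) ∧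
    ∫ r, |z.im| * (bra r ^ 3)⁻¹ / (phaseDeriv z ρ r ^ 2 + N) ≤ Real.pi / Real.sqrt N := by
  have hcont : Continuous (fun r => |z.im| * (bra r ^ 3)⁻¹ / (phaseDeriv z ρ r ^ 2 + N)) := by
    have h1 := fun r => (pow_pos (bra_pos r) 3).ne'
    have h2 : ∀ r, phaseDeriv z ρ r ^ 2 + N ≠ 0 := fun r => by positivity
    fun_prop (disch := assumption)
  have hint : Integrable (fun r => |z.im| * (bra r ^ 3)⁻¹ / (phaseDeriv z ρ r ^ 2 + N)) := by
    refine (integrable_inv_one_add_sq.const_mul (|z.im| / N)).mono' hcont.aestronglyMeasurable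
      (Filter.Eventually.of_forall fun r => ?_)
    have := bra_pos r
    rw [Real.norm_of_nonneg (by positivity), div_mul_eq_mul_div]
    have h1 := one_le_bra r
    gcongr
    · rw [← bra_sq]; exact pow_le_pow_right₀ h1 (by norm_num)
    · nlinarith [sq_nonneg (phaseDeriv z ρ r)]
  refine ⟨hint, ?_⟩
  have hlim := intervalIntegral_tendsto_integral hint
    Filter.tendsto_neg_atTop_atBot Filter.tendsto_id
  refine le_of_tendsto hlim (Filter.Eventually.of_forall fun T => ?_)
  -- `σ` is the sign of the derivative of the monotone function `p`
  obtain ⟨σ, hσ, hσ'⟩ : ∃ σ : ℝ, |σ| = 1 ∧ -(σ * z.im) = |z.im| := by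
    rcases le_total 0 z.im with h | h
    · exact ⟨-1, by simp, by rw [abs_of_nonneg h]; ring⟩
    · exact ⟨1, by simp, by rw [abs_of_nonpos h]; ring⟩
  have hsN := Real.sqrt_pos.2 hN
  set F : ℝ → ℝ := fun r => σ / Real.sqrt N * Real.arctan (phaseDeriv z ρ r / Real.sqrt N) with hF
  have hd : ∀ r, HasDerivAt F (|z.im| * (bra r ^ 3)⁻¹ / (phaseDeriv z ρ r ^ 2 + N)) r := fun r => by
    have h := (((hasDerivAt_phaseDeriv z ρ r).div_const (Real.sqrt N)).arctan).const_mul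
      (σ / Real.sqrt N)
    refine h.congr_deriv ?_
    have hs := Real.sq_sqrt hN.le
    have h2 : phaseDeriv z ρ r ^ 2 + N ≠ 0 := by positivity
    have h3 : 1 + (phaseDeriv z ρ r / Real.sqrt N) ^ 2 = (phaseDeriv z ρ r ^ 2 + N) / N := by
      rw [div_pow, hs]; field_simp; ring
    rw [h3, ← hσ']
    have h4 := bra_pos r
    field_simp
    rw [hs]
  rw [intervalIntegral.integral_eq_sub_of_hasDerivAt (fun r _ => hd r)
    (hcont.intervalIntegrable _ _)]
  have hb : ∀ r, |F r| ≤ Real.pi / 2 / Real.sqrt N := fun r => by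
    rw [hF, abs_mul, abs_div, hσ, abs_of_pos hsN, div_mul_eq_mul_div, one_mul]
    gcongr
    exact abs_le.2 ⟨(Real.neg_pi_div_two_lt_arctan _).le, (Real.arctan_lt_pi_div_two _).le⟩
  have h1 := abs_le.1 (hb T)
  have h2 := abs_le.1 (hb (-T))
  have : Real.pi / Real.sqrt N = Real.pi / 2 / Real.sqrt N + Real.pi / 2 / Real.sqrt N := by ring
  simp only [id] at *
  linarith [h1.2, h2.1]

/-- Van der Corput's second derivative test for `osc`. With `p` the phase derivative and
`N = |Im z|`, write `1 = N / (p² + N) + p² / (p² + N)` and integrate by parts in the second term,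
where one factor `p` is absorbed by the oscillation. -/
lemma norm_integral_osc_le {b : ℝ} (hb : 0 < b) {z : ℂ} (hz : b ≤ z.re) (hz' : z.im ≠ 0) (ρ : ℝ) :
    ‖∫ r, osc z ρ r‖ ≤ ((((min (b / 3) 1) ^ 3)⁻¹ + 1) * Real.pi + 1) / Real.sqrt |z.im| := by
  have hz0 : 0 < z.re := hb.trans_le hz
  set M := ((min (b / 3) 1) ^ 3)⁻¹ with hM
  set N := |z.im| with hNdef
  have hN : 0 < N := abs_pos.2 hz'
  have hsN := Real.sqrt_pos.2 hN
  have hsq := Real.sq_sqrt hN.le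
  set p := phaseDeriv z ρ with hp
  have hpN : ∀ r, 0 < p r ^ 2 + N := fun r => by positivity
  set v : ℝ → ℝ := fun r => r / bra r with hv
  set p' : ℝ → ℝ := fun r => -(z.im * (bra r ^ 3)⁻¹) with hp'
  have hp'abs : ∀ r, |p' r| = N * (bra r ^ 3)⁻¹ := fun r => by
    have := bra_pos r
    rw [hp', abs_neg, abs_mul, abs_of_pos (inv_pos.2 (pow_pos this 3))]
  set q : ℝ → ℝ := fun r => p r / (p r ^ 2 + N) with hq
  set q' : ℝ → ℝ := fun r => p' r * (N - p r ^ 2) / (p r ^ 2 + N) ^ 2 with hq'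
  have hdq : ∀ r, HasDerivAt q (q' r) r := fun r => by
    have h1 := hasDerivAt_phaseDeriv z ρ r
    refine (h1.div ((h1.pow 2).add_const N) (hpN r).ne').congr_deriv ?_
    simp only [hq', hp', hp, Pi.pow_apply]
    congr 1
    push_cast
    ring
  have hqb : ∀ r, |q r| ≤ 1 / (2 * Real.sqrt N) := fun r => by
    rw [hq, abs_div, abs_of_pos (hpN r), div_le_div_iff₀ (hpN r) (by positivity)]
    nlinarith [sq_nonneg (|p r| - Real.sqrt N), sq_abs (p r)]
  have hq'b : ∀ r, |q' r| ≤ N * (bra r ^ 3)⁻¹ / (p r ^ 2 + N) := fun r => by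
    have h1 : |N - p r ^ 2| ≤ p r ^ 2 + N := abs_le.2 ⟨by linarith, by nlinarith [sq_nonneg (p r)]⟩
    have h2 := bra_pos r
    rw [hq', abs_div, abs_mul, hp'abs, abs_of_pos (pow_pos (hpN r) 2),
      div_le_div_iff₀ (pow_pos (hpN r) 2) (hpN r)]
    have h3 : 0 ≤ N * (bra r ^ 3)⁻¹ := by positivity
    calc N * (bra r ^ 3)⁻¹ * |N - p r ^ 2| * (p r ^ 2 + N)
        ≤ N * (bra r ^ 3)⁻¹ * (p r ^ 2 + N) * (p r ^ 2 + N) := by gcongr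
      _ = _ := by ring
  obtain ⟨hI1, hI2⟩ := integral_phaseDeriv_le z ρ hN
  have hcp : Continuous p := continuous_phaseDeriv z ρ
  have hcq : Continuous q := hcp.div (by fun_prop) fun r => (hpN r).ne'
  have hcq' : Continuous q' := by
    refine Continuous.div ?_ (by fun_prop) fun r => (pow_pos (hpN r) 2).ne'
    have h1 := fun r => (pow_pos (bra_pos r) 3).ne'
    fun_prop (disch := assumption)
  -- `osc = R - i F'`, where `∫ F' = 0` and every term of `R` is absolutely small
  set F : ℝ → ℂ := fun r => osc z ρ r * (q r : ℂ) with hF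
  set R : ℝ → ℂ := fun r => osc z ρ r * ((N / (p r ^ 2 + N) : ℝ) : ℂ)
    - Complex.I * (((z.re * v r * q r : ℝ) : ℂ) * osc z ρ r - osc z ρ r * (q' r : ℂ)) with hR
  set F' : ℝ → ℂ := fun r => (Complex.I * (p r : ℂ) - ((z.re * (r / bra r) : ℝ) : ℂ)) * osc z ρ r
    * (q r : ℂ) + osc z ρ r * (q' r : ℂ) with hF'
  have hdF : ∀ r, HasDerivAt F (F' r) r := fun r =>
    (hasDerivAt_osc z ρ r).mul (hdq r).ofReal_comp
  have hsplit : ∀ r, osc z ρ r = R r - Complex.I * F' r := fun r => by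
    have h1 : ((N / (p r ^ 2 + N) : ℝ) : ℂ) + (p r : ℂ) * (q r : ℂ) = 1 := by
      rw [← Complex.ofReal_mul, ← Complex.ofReal_add, ← Complex.ofReal_one]
      congr 1
      have := (hpN r).ne'
      simp only [hq]
      field_simp
      ring
    simp only [hR, hF', hv]
    push_cast at h1 ⊢
    linear_combination (-osc z ρ r) * h1 + (p r * q r * osc z ρ r : ℂ) * Complex.I_sq
  set G : ℝ → ℝ := fun r => (M + 1) * (N * (bra r ^ 3)⁻¹ / (p r ^ 2 + N))
    + 1 / (2 * Real.sqrt N) * (z.re * (|r| / bra r) * amp z.re r) with hG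
  have hGint : Integrable G :=
    (hI1.const_mul _).add ((integrable_velocity_mul_amp hz0).const_mul _)
  have hRG : ∀ r, ‖R r‖ ≤ G r := fun r => by
    have ha := amp_pos z.re r
    have hE := bra_pos r
    have t1 : ‖osc z ρ r * ((N / (p r ^ 2 + N) : ℝ) : ℂ)‖
        ≤ M * (N * (bra r ^ 3)⁻¹ / (p r ^ 2 + N)) := by
      rw [norm_mul, norm_osc, Complex.norm_real, Real.norm_of_nonneg
        (div_nonneg hN.le (hpN r).le)]
      have h3 : amp z.re r ≤ M * (bra r ^ 3)⁻¹ := by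
        rw [← div_eq_mul_inv, le_div_iff₀ (pow_pos hE 3)]
        exact amp_mul_bra_cube_le hb hz r
      calc amp z.re r * (N / (p r ^ 2 + N)) ≤ M * (bra r ^ 3)⁻¹ * (N / (p r ^ 2 + N)) := by
            have := div_nonneg hN.le (hpN r).le
            gcongr
        _ = _ := by ring
    have t2 : ‖((z.re * v r * q r : ℝ) : ℂ) * osc z ρ r‖
        ≤ 1 / (2 * Real.sqrt N) * (z.re * (|r| / bra r) * amp z.re r) := by
      rw [norm_mul, norm_osc, Complex.norm_real, Real.norm_eq_abs, abs_mul, abs_mul,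
        abs_of_pos hz0, hv, abs_div, abs_of_pos hE]
      have h0 : 0 ≤ |r| / bra r := div_nonneg (abs_nonneg _) hE.le
      calc z.re * (|r| / bra r) * |q r| * amp z.re r
          ≤ z.re * (|r| / bra r) * (1 / (2 * Real.sqrt N)) * amp z.re r := by
            gcongr; exact hqb r
        _ = _ := by ring
    have t3 : ‖osc z ρ r * (q' r : ℂ)‖ ≤ N * (bra r ^ 3)⁻¹ / (p r ^ 2 + N) := by
      rw [norm_mul, norm_osc, Complex.norm_real, Real.norm_eq_abs]
      calc amp z.re r * |q' r| ≤ 1 * |q' r| := by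
            gcongr; exact amp_le_one hz0.le r
        _ ≤ _ := by rw [one_mul]; exact hq'b r
    calc ‖R r‖ ≤ ‖osc z ρ r * ((N / (p r ^ 2 + N) : ℝ) : ℂ)‖
          + (‖((z.re * v r * q r : ℝ) : ℂ) * osc z ρ r‖ + ‖osc z ρ r * (q' r : ℂ)‖) := by
          refine (norm_sub_le _ _).trans ?_
          rw [norm_mul Complex.I, Complex.norm_I, one_mul]
          gcongr
          exact norm_sub_le _ _
      _ ≤ _ := by simp only [hG]; linarith
  have hRint : Integrable R := by
    refine hGint.mono' ?_ (Filter.Eventually.of_forall hRG)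
    refine Continuous.aestronglyMeasurable ?_
    have h1 : Continuous v := continuous_velocity
    have h2 := fun r => (hpN r).ne'
    fun_prop (disch := assumption)
  have hF'int : Integrable F' := by
    have h : F' = fun r => Complex.I * (osc z ρ r - R r) := by
      ext r
      rw [hsplit r, sub_sub_cancel_left, mul_neg, ← mul_assoc, Complex.I_mul_I]
      ring
    rw [h]
    exact ((integrable_osc hz0 ρ).sub hRint).const_mul _
  have hFint : Integrable F := by
    refine ((integrable_osc hz0 ρ).norm.mul_const (1 / (2 * Real.sqrt N))).mono'
      (Continuous.aestronglyMeasurable (by fun_prop)) (Filter.Eventually.of_forall fun r => ?_)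
    simp only [hF]
    rw [norm_mul, Complex.norm_real]
    gcongr
    exact hqb r
  have hzero := integral_eq_zero_of_hasDerivAt_of_integrable hdF hF'int hFint
  have hI : ∫ r, osc z ρ r = ∫ r, R r := by
    rw [integral_congr_ae (Filter.Eventually.of_forall hsplit),
      integral_sub hRint (hF'int.const_mul _), integral_const_mul, hzero, mul_zero, sub_zero]
  rw [hI]
  refine (norm_integral_le_of_norm_le hGint (Filter.Eventually.of_forall hRG)).trans ?_
  rw [integral_add (hI1.const_mul _) ((integrable_velocity_mul_amp hz0).const_mul _),
    integral_const_mul, integral_const_mul, integral_velocity_mul_amp hz0]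
  have hM0 : 0 ≤ M := by positivity
  calc (M + 1) * (∫ r, N * (bra r ^ 3)⁻¹ / (p r ^ 2 + N)) + 1 / (2 * Real.sqrt N) * 2
      ≤ (M + 1) * (Real.pi / Real.sqrt N) + 1 / (2 * Real.sqrt N) * 2 := by gcongr
    _ = _ := by field_simp

/-- The amplitude bound for `osc`, which is the better one for `|Im z| ≤ Re z`. -/
lemma norm_integral_osc_le_amp {b : ℝ} (hb : 0 < b) {z : ℂ} (hz : b ≤ z.re) (ρ : ℝ) :
    ‖∫ r, osc z ρ r‖ ≤ (3 + 18 / b) * Real.pi / Real.sqrt z.re :=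
  (norm_integral_le_of_norm_le (integrable_amp (hb.trans_le hz))
    (Filter.Eventually.of_forall fun r => (norm_osc z ρ r).le)).trans (integral_amp_le hb hz)

/-- The nonstationary case: the phase derivative is bounded below by `ρ/2`. Dividing by the full
logarithmic derivative `d` of `osc`, and not only by the phase derivative, one integration by parts
gains two powers of `ρ`. -/
lemma norm_integral_osc_le_of_nonstationary {b : ℝ} (hb : 0 < b) {z : ℂ} (hz : b ≤ z.re) {ρ : ℝ}
    (hρ : 0 < ρ) (hzρ : 2 * |z.im| ≤ ρ) :
    ‖∫ r, osc z ρ r‖ ≤ (3 + 18 / b) * Real.pi / Real.sqrt z.re * (4 * ‖z‖ / ρ ^ 2) := by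
  have hz0 : 0 < z.re := hb.trans_le hz
  set d : ℝ → ℂ := fun r => Complex.I * (ρ : ℂ) - z * ((r / bra r : ℝ) : ℂ) with hd
  have hdlow : ∀ r, ρ / 2 ≤ ‖d r‖ := fun r => by
    refine le_trans ?_ (Complex.abs_im_le_norm _)
    have h1 : (d r).im = ρ - z.im * (r / bra r) := by
      simp only [hd, Complex.sub_im, Complex.mul_im, Complex.I_re, Complex.I_im,
        Complex.ofReal_re, Complex.ofReal_im]
      ring
    have h2 : |z.im * (r / bra r)| ≤ |z.im| := by
      rw [abs_mul]
      exact mul_le_of_le_one_right (abs_nonneg _) (abs_velocity_le r)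
    rw [h1]
    refine le_trans ?_ (le_abs_self _)
    linarith [le_abs_self (z.im * (r / bra r))]
  have hd0 : ∀ r, d r ≠ 0 := fun r h => by
    have := hdlow r
    rw [h, norm_zero] at this
    linarith
  have hderiv : ∀ r, HasDerivAt d (-(z * (((bra r ^ 3)⁻¹ : ℝ) : ℂ))) r := fun r =>
    ((hasDerivAt_velocity r).ofReal_comp.const_mul z).const_sub _
  have hosc : ∀ r, HasDerivAt (osc z ρ) (d r * osc z ρ r) r := fun r => by
    refine (hasDerivAt_osc z ρ r).congr_deriv ?_
    congr 1
    simp only [hd]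
    conv_rhs => rw [← Complex.re_add_im z]
    simp only [phaseDeriv]
    push_cast
    ring
  set R : ℝ → ℂ := fun r => osc z ρ r * (z * (((bra r ^ 3)⁻¹ : ℝ) : ℂ)) / d r ^ 2 with hR
  have hdF : ∀ r, HasDerivAt (fun r => osc z ρ r / d r) (osc z ρ r + R r) r := fun r => by
    refine ((hosc r).div (hderiv r) (hd0 r)).congr_deriv ?_
    have := hd0 r
    simp only [hR]
    field_simp
    ring
  have hRb : ∀ r, ‖R r‖ ≤ amp z.re r * (4 * ‖z‖ / ρ ^ 2) := fun r => by
    have hE := one_le_bra r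
    have h3 : (bra r ^ 3)⁻¹ ≤ 1 := inv_le_one_of_one_le₀ (one_le_pow₀ hE)
    have h30 : 0 ≤ (bra r ^ 3)⁻¹ := by have := bra_pos r; positivity
    have h4 : (ρ / 2) ^ 2 ≤ ‖d r‖ ^ 2 := by gcongr; exact hdlow r
    simp only [hR]
    rw [norm_div, norm_mul, norm_mul, norm_osc, norm_pow, Complex.norm_real,
      Real.norm_of_nonneg h30, mul_div_assoc]
    refine mul_le_mul_of_nonneg_left ?_ (amp_pos z.re r).le
    calc ‖z‖ * (bra r ^ 3)⁻¹ / ‖d r‖ ^ 2 ≤ ‖z‖ * 1 / (ρ / 2) ^ 2 := by gcongr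
      _ = _ := by rw [div_pow]; field_simp; norm_num
  have hcd : Continuous d := by
    simp only [hd]
    have := continuous_velocity
    fun_prop
  have hRint : Integrable R := by
    refine ((integrable_amp hz0).mul_const _).mono' (Continuous.aestronglyMeasurable ?_)
      (Filter.Eventually.of_forall hRb)
    have h1 := fun r => (pow_pos (bra_pos r) 3).ne'
    have h2 := fun r => pow_ne_zero 2 (hd0 r)
    refine Continuous.div ?_ (by fun_prop) h2
    fun_prop (disch := assumption)
  have hFint : Integrable (fun r => osc z ρ r / d r) := by
    refine ((integrable_amp hz0).mul_const (ρ / 2)⁻¹).mono' (Continuous.aestronglyMeasurable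
      ((continuous_osc z ρ).div hcd hd0)) (Filter.Eventually.of_forall fun r => ?_)
    rw [norm_div, norm_osc, div_eq_mul_inv]
    have ha := (amp_pos z.re r).le
    gcongr
    exact hdlow r
  have hzero := integral_eq_zero_of_hasDerivAt_of_integrable hdF
    ((integrable_osc hz0 ρ).add hRint) hFint
  rw [integral_add (integrable_osc hz0 ρ) hRint] at hzero
  rw [eq_neg_of_add_eq_zero_left hzero, norm_neg]
  refine (norm_integral_le_of_norm_le ((integrable_amp hz0).mul_const _)
    (Filter.Eventually.of_forall hRb)).trans ?_
  rw [integral_mul_const]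
  gcongr
  exact integral_amp_le hb hz

/-! ### Orthonormal coordinates and the kernel on `ℝ³` -/

/-- The coordinates of a vector with respect to an orthonormal basis. -/
noncomputable def coords (b : OrthonormalBasis (Fin 3) ℝ E3) (ξ : E3) : ℝ × ℝ × ℝ :=
  (inner ℝ (b 0) ξ, inner ℝ (b 1) ξ, inner ℝ (b 2) ξ)

/-- `coords b` as a measurable equivalence. -/
noncomputable def coordsEquiv (b : OrthonormalBasis (Fin 3) ℝ E3) : E3 ≃ᵐ ℝ × ℝ × ℝ :=
  (b.repr.toMeasurableEquiv.trans (MeasurableEquiv.toLp 2 (Fin 3 → ℝ)).symm).trans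
    ((MeasurableEquiv.piFinSuccAbove (fun _ : Fin 3 => ℝ) 0).trans
      ((MeasurableEquiv.refl ℝ).prodCongr MeasurableEquiv.finTwoArrow))

lemma coordsEquiv_apply (b : OrthonormalBasis (Fin 3) ℝ E3) (ξ : E3) :
    coordsEquiv b ξ = coords b ξ := by
  simp only [coords, ← b.repr_apply_apply]
  rfl

lemma measurePreserving_coordsEquiv (b : OrthonormalBasis (Fin 3) ℝ E3) :
    MeasurePreserving (coordsEquiv b) := by
  refine (b.measurePreserving_repr.trans (PiLp.volume_preserving_ofLp (Fin 3))).trans ?_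
  refine (volume_preserving_piFinSuccAbove (fun _ : Fin 3 => ℝ) 0).trans ?_
  exact (MeasurePreserving.id volume).prod (volume_preserving_finTwoArrow ℝ)

lemma integral_comp_coords (b : OrthonormalBasis (Fin 3) ℝ E3) (Ψ : ℝ × ℝ × ℝ → ℂ) :
    ∫ ξ, Ψ (coords b ξ) = ∫ p, Ψ p := by
  simp only [← coordsEquiv_apply]
  exact (measurePreserving_coordsEquiv b).integral_comp' Ψ

lemma integrable_comp_coords (b : OrthonormalBasis (Fin 3) ℝ E3) {F : Type*}
    [NormedAddCommGroup F] (Ψ : ℝ × ℝ × ℝ → F) :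
    Integrable (fun ξ => Ψ (coords b ξ)) ↔ Integrable Ψ := by
  simp only [← coordsEquiv_apply]
  exact (measurePreserving_coordsEquiv b).integrable_comp_emb (coordsEquiv b).measurableEmbedding

/-- The squared norm of a triple of coordinates. -/
def sqNorm (p : ℝ × ℝ × ℝ) : ℝ := p.1 ^ 2 + p.2.1 ^ 2 + p.2.2 ^ 2

lemma sqNorm_coords (b : OrthonormalBasis (Fin 3) ℝ E3) (ξ : E3) :
    sqNorm (coords b ξ) = ‖ξ‖ ^ 2 := by
  rw [← b.sum_sq_inner_right ξ, Fin.sum_univ_three]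
  rfl

lemma inner_eq_coords (b : OrthonormalBasis (Fin 3) ℝ E3) (x ξ : E3) :
    inner ℝ x ξ = (coords b x).1 * (coords b ξ).1 + (coords b x).2.1 * (coords b ξ).2.1
      + (coords b x).2.2 * (coords b ξ).2.2 := by
  rw [← b.sum_inner_mul_inner, Fin.sum_univ_three]
  simp only [coords, real_inner_comm]

lemma exists_orthonormalBasis_smul (x : E3) :
    ∃ b : OrthonormalBasis (Fin 3) ℝ E3, x = ‖x‖ • b 0 := by
  by_cases hx : x = 0
  · exact ⟨EuclideanSpace.basisFun (Fin 3) ℝ, by simp [hx]⟩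
  have hx' : ‖x‖ ≠ 0 := norm_ne_zero_iff.2 hx
  have hv : Orthonormal ℝ (Set.domRestrict ({0} : Set (Fin 3)) fun _ : Fin 3 => ‖x‖⁻¹ • x) := by
    constructor
    · intro i
      simp [norm_smul, hx']
    · intro i j hij
      exact absurd (Subsingleton.elim i j) hij
  obtain ⟨b, hb⟩ := hv.exists_orthonormalBasis_extension_of_card_eq (by simp)
  exact ⟨b, by rw [hb 0 rfl, smul_inv_smul₀ hx']⟩

/-- `⟨ξ⟩` in orthonormal coordinates. -/
noncomputable def bra3 (p : ℝ × ℝ × ℝ) : ℝ := Real.sqrt (1 + sqNorm p)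

lemma bracket_eq_bra3 (b : OrthonormalBasis (Fin 3) ℝ E3) (ξ : E3) :
    bracket ξ = bra3 (coords b ξ) := by rw [bra3, sqNorm_coords, bracket]

@[fun_prop]
lemma continuous_bra3 : Continuous bra3 := by unfold bra3 sqNorm; fun_prop

@[fun_prop]
lemma continuous_bracket : Continuous bracket := by unfold bracket; fun_prop

lemma sqNorm_nonneg (p : ℝ × ℝ × ℝ) : 0 ≤ sqNorm p := by unfold sqNorm; positivity

lemma one_le_bra3 (p : ℝ × ℝ × ℝ) : 1 ≤ bra3 p := by
  rw [bra3, Real.one_le_sqrt]; linarith [sqNorm_nonneg p]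

lemma bracket_sq (ξ : E3) : bracket ξ ^ 2 = 1 + ‖ξ‖ ^ 2 := Real.sq_sqrt (by positivity)

lemma one_le_bracket (ξ : E3) : 1 ≤ bracket ξ := by
  rw [bracket, Real.one_le_sqrt]; nlinarith [sq_nonneg ‖ξ‖]

lemma norm_le_bracket (ξ : E3) : ‖ξ‖ ≤ bracket ξ := by
  rw [bracket]; exact Real.le_sqrt_of_sq_le (by linarith)

lemma integrable_exp_neg_bracket {c : ℝ} (hc : 0 < c) :
    Integrable (fun ξ : E3 => Real.exp (-(c * bracket ξ))) := by
  have h := integrable_rpow_neg_one_add_norm_sq (E := E3) (μ := volume) (r := 4)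
    (by rw [finrank_euclideanSpace_fin]; norm_num)
  refine (h.const_mul (24 / c ^ 4)).mono' (by fun_prop) (Filter.Eventually.of_forall fun ξ => ?_)
  have hE := one_le_bracket ξ
  have e : ((1 : ℝ) + ‖ξ‖ ^ 2) ^ (-(4 : ℝ) / 2) = (bracket ξ ^ 4)⁻¹ := by
    have e2 : (-(4 : ℝ) / 2) = -((2 : ℕ) : ℝ) := by norm_num
    rw [← bracket_sq, e2, Real.rpow_neg (by positivity), Real.rpow_natCast, ← pow_mul]
  rw [e, Real.norm_of_nonneg (Real.exp_pos _).le, Real.exp_neg]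
  have h1 := Real.pow_div_factorial_le_exp (x := c * bracket ξ) (by positivity) 4
  rw [← div_eq_mul_inv, div_div]
  rw [inv_le_comm₀ (Real.exp_pos _) (by positivity), inv_div]
  refine le_trans (le_of_eq ?_) h1
  simp [Nat.factorial]
  ring

lemma integrable_exp_neg_bra3 {c : ℝ} (hc : 0 < c) :
    Integrable (fun p : ℝ × ℝ × ℝ => Real.exp (-(c * bra3 p))) := by
  have b := EuclideanSpace.basisFun (Fin 3) ℝ
  rw [← integrable_comp_coords b]
  simpa only [bracket_eq_bra3 b] using integrable_exp_neg_bracket hc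

/-- The planar integral which makes the three-dimensional kernel explicit: in polar coordinates the
integrand is an exact derivative. -/
lemma integral_plane {z : ℂ} (hz : 0 < z.re) (r : ℝ) :
    ∫ y : ℝ × ℝ, Complex.exp (-z * ((Real.sqrt (1 + r ^ 2 + (y.1 ^ 2 + y.2 ^ 2)) - 1 : ℝ) : ℂ))
      / ((Real.sqrt (1 + r ^ 2 + (y.1 ^ 2 + y.2 ^ 2)) : ℝ) : ℂ)
      = 2 * Real.pi / z * Complex.exp (-z * ((bra r - 1 : ℝ) : ℂ)) := by
  have hz0 : z ≠ 0 := fun h => by rw [h] at hz; simp at hz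
  set S : ℝ → ℝ := fun s => Real.sqrt (1 + r ^ 2 + s ^ 2) with hS
  have hSpos : ∀ s, 0 < S s := fun s => Real.sqrt_pos.2 (by positivity)
  have hdS : ∀ s, HasDerivAt S (s / S s) s := fun s => by
    have h : HasDerivAt (fun s : ℝ => 1 + r ^ 2 + s ^ 2) (2 * s) s := by
      simpa using (hasDerivAt_pow 2 s).const_add (1 + r ^ 2)
    have h2 := h.sqrt (by positivity)
    rwa [mul_div_mul_left _ _ two_ne_zero] at h2
  set F : ℝ → ℂ := fun s => Complex.exp (-z * ((S s - 1 : ℝ) : ℂ)) with hF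
  have hdF : ∀ s, HasDerivAt F (F s * (-z * ((s / S s : ℝ) : ℂ))) s := fun s =>
    (((hdS s).sub_const 1).ofReal_comp.const_mul (-z)).cexp
  have hSbra : ∀ s, bra s ≤ S s := fun s => Real.sqrt_le_sqrt (by nlinarith [sq_nonneg r])
  have hnF : ∀ s, ‖F s‖ ≤ amp z.re s := fun s => by
    rw [hF, Complex.norm_exp, amp]
    refine Real.exp_le_exp.2 ?_
    rw [Complex.mul_re]
    simp only [Complex.neg_re, Complex.ofReal_re, Complex.ofReal_im, mul_zero, sub_zero]
    have := hSbra s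
    nlinarith
  have hcS : Continuous S := by simp only [hS]; fun_prop
  have hcF : Continuous F := by simp only [hF]; fun_prop
  have hvel : ∀ s, |s / S s| ≤ 1 := fun s => by
    rw [abs_div, abs_of_pos (hSpos s), div_le_one (hSpos s)]
    exact (abs_le_bra s).trans (hSbra s)
  have hcF' : Continuous (fun s => F s * (-z * ((s / S s : ℝ) : ℂ))) := by
    have := fun s => (hSpos s).ne'
    fun_prop (disch := assumption)
  have hint : Integrable (fun s => F s * (-z * ((s / S s : ℝ) : ℂ))) := by
    refine ((integrable_amp hz).mul_const ‖z‖).mono' hcF'.aestronglyMeasurable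
      (Filter.Eventually.of_forall fun s => ?_)
    rw [norm_mul, norm_mul, norm_neg, Complex.norm_real]
    have h1 := hnF s
    have h2 := hvel s
    have h3 := amp_pos z.re s
    calc ‖F s‖ * (‖z‖ * ‖s / S s‖) ≤ amp z.re s * (‖z‖ * 1) := by gcongr; exact h2
      _ = _ := by ring
  have hlim : Filter.Tendsto F Filter.atTop (nhds 0) := by
    rw [tendsto_zero_iff_norm_tendsto_zero]
    refine squeeze_zero (fun _ => norm_nonneg _) hnF (Real.tendsto_exp_atBot.comp ?_)
    refine Filter.tendsto_neg_atTop_atBot.comp (Filter.Tendsto.const_mul_atTop hz ?_)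
    exact Filter.tendsto_atTop_add_const_right _ _ tendsto_bra_atTop
  have hFTC := integral_Ioi_of_hasDerivAt_of_tendsto' (a := 0) (fun s _ => hdF s)
    hint.integrableOn hlim
  have hF0 : F 0 = Complex.exp (-z * ((bra r - 1 : ℝ) : ℂ)) := by simp [hF, hS, bra]
  rw [← integral_comp_polarCoord_symm, polarCoord_target]
  have e : ∀ p ∈ Set.Ioi (0 : ℝ) ×ˢ Set.Ioo (-Real.pi) Real.pi,
      p.1 • (Complex.exp (-z * ((Real.sqrt (1 + r ^ 2 + ((polarCoord.symm p).1 ^ 2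
        + (polarCoord.symm p).2 ^ 2)) - 1 : ℝ) : ℂ))
      / ((Real.sqrt (1 + r ^ 2 + ((polarCoord.symm p).1 ^ 2 + (polarCoord.symm p).2 ^ 2)) : ℝ) : ℂ))
      = (-1 / z * (F p.1 * (-z * ((p.1 / S p.1 : ℝ) : ℂ)))) * (fun _ => (1 : ℂ)) p.2 := fun p _ => by
    have h1 : (polarCoord.symm p).1 ^ 2 + (polarCoord.symm p).2 ^ 2 = p.1 ^ 2 := by
      rw [polarCoord_symm_apply]
      simp only
      nlinarith [Real.sin_sq_add_cos_sq p.2]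
    rw [h1]
    simp only [hF, hS, Complex.real_smul]
    push_cast
    field_simp
  rw [setIntegral_congr_fun (measurableSet_Ioi.prod measurableSet_Ioo) e, Measure.volume_eq_prod,
    setIntegral_prod_mul (fun s => -1 / z * (F s * (-z * ((s / S s : ℝ) : ℂ)))) (fun _ => (1 : ℂ)),
    integral_const_mul, hFTC, hF0]
  simp only [integral_const, MeasurableSet.univ, measureReal_restrict_apply, Set.univ_inter,
    Real.volume_real_Ioo, Complex.real_smul, mul_one]
  rw [max_eq_left (by linarith [Real.pi_pos])]
  push_cast
  field_simp
  ring

/-- The kernel `∫ e^{ix·ξ - z(⟨ξ⟩ - 1)} dξ/⟨ξ⟩`. -/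
noncomputable def kernel (z : ℂ) (x : E3) : ℂ :=
  ∫ ξ : E3, Complex.exp (Complex.I * ((inner ℝ x ξ : ℝ) : ℂ)) *
    (Complex.exp (-z * ((bracket ξ - 1 : ℝ) : ℂ)) / ((bracket ξ : ℝ) : ℂ))

lemma norm_cexp_mul_ofReal (z : ℂ) (s : ℝ) : ‖Complex.exp (-z * (s : ℂ))‖ = Real.exp (-(z.re * s)) := by
  rw [Complex.norm_exp]
  simp

/-- Slicing orthogonally to `x` reduces the kernel to an oscillatory integral on the line and gives
a factor `1/z`, which is the decay caused by the two angular directions. -/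
lemma kernel_eq {z : ℂ} (hz : 0 < z.re) (x : E3) :
    kernel z x = 2 * Real.pi / z * ∫ r, osc z ‖x‖ r := by
  obtain ⟨b, hb⟩ := exists_orthonormalBasis_smul x
  have hx1 : ∀ ξ, inner ℝ x ξ = ‖x‖ * (coords b ξ).1 := fun ξ => by
    conv_lhs => rw [hb]
    rw [real_inner_smul_left]
    rfl
  set Ψ : ℝ × ℝ × ℝ → ℂ := fun p => Complex.exp (Complex.I * ((‖x‖ * p.1 : ℝ) : ℂ)) *
    (Complex.exp (-z * ((bra3 p - 1 : ℝ) : ℂ)) / ((bra3 p : ℝ) : ℂ)) with hΨ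
  have hint : Integrable Ψ := by
    refine ((integrable_exp_neg_bra3 hz).const_mul (Real.exp z.re)).mono' ?_
      (Filter.Eventually.of_forall fun p => ?_)
    · refine Continuous.aestronglyMeasurable ?_
      have : ∀ p, ((bra3 p : ℝ) : ℂ) ≠ 0 := fun p => by
        have := one_le_bra3 p
        exact Complex.ofReal_ne_zero.2 (by linarith)
      fun_prop (disch := assumption)
    · have h1 := one_le_bra3 p
      rw [hΨ, norm_mul, mul_comm Complex.I, Complex.norm_exp_ofReal_mul_I, one_mul, norm_div,
        norm_cexp_mul_ofReal, Complex.norm_real, Real.norm_of_nonneg (by linarith), ← Real.exp_add]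
      refine (div_le_self (Real.exp_pos _).le h1).trans (le_of_eq ?_)
      congr 1
      ring
  have h := integral_comp_coords b Ψ
  simp only [hΨ, ← bracket_eq_bra3, ← hx1] at h
  rw [kernel, h, Measure.volume_eq_prod, integral_prod _ hint, ← integral_const_mul]
  refine integral_congr_ae (Filter.Eventually.of_forall fun r => ?_)
  have h2 : ∀ y : ℝ × ℝ, bra3 (r, y) = Real.sqrt (1 + r ^ 2 + (y.1 ^ 2 + y.2 ^ 2)) := fun y => by
    rw [bra3, sqNorm]; congr 1; ring
  simp only [hΨ, h2]
  rw [integral_const_mul, integral_plane hz, osc, Complex.exp_sub, neg_mul, Complex.exp_neg]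
  ring

lemma norm_kernel {z : ℂ} (hz : 0 < z.re) (x : E3) :
    ‖kernel z x‖ = 2 * Real.pi / ‖z‖ * ‖∫ r, osc z ‖x‖ r‖ := by
  rw [kernel_eq hz, norm_mul, norm_div, norm_mul, Complex.norm_real, Real.norm_of_nonneg
    Real.pi_pos.le]
  simp

/-! ### Decay of the kernel -/

lemma rpow_three_halves {s : ℝ} (hs : 0 < s) : s ^ (-(3 / 2) : ℝ) = (s * Real.sqrt s)⁻¹ := by
  rw [Real.rpow_neg hs.le, Real.sqrt_eq_rpow, show (3 / 2 : ℝ) = 1 + 1 / 2 by norm_num,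
    Real.rpow_add hs, Real.rpow_one]

/-- The dispersive estimate, uniform in the spatial variable. -/
lemma exists_norm_kernel_le {b : ℝ} (hb : 0 < b) : ∃ C : ℝ, 0 < C ∧ ∀ z : ℂ, b ≤ z.re → ∀ x : E3,
    ‖kernel z x‖ ≤ C * (z.re + |z.im|) ^ (-(3 / 2) : ℝ) := by
  set C₁ := max ((3 + 18 / b) * Real.pi) ((((min (b / 3) 1) ^ 3)⁻¹ + 1) * Real.pi + 1) with hC₁
  have hC₁0 : 0 < C₁ := lt_max_of_lt_left (by positivity)
  refine ⟨2 * Real.pi * 2 * C₁ * 2, by positivity, fun z hz x => ?_⟩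
  have hz0 : 0 < z.re := hb.trans_le hz
  set s := z.re + |z.im| with hs
  have hs0 : 0 < s := by positivity
  have hzn : s / 2 ≤ ‖z‖ := by
    have h1 := Complex.abs_re_le_norm z
    have h2 := Complex.abs_im_le_norm z
    rw [abs_of_pos hz0] at h1
    linarith
  have hosc : ‖∫ r, osc z ‖x‖ r‖ ≤ C₁ / Real.sqrt (s / 4) := by
    have h4 : 0 < Real.sqrt (s / 4) := Real.sqrt_pos.2 (by positivity)
    rcases le_total |z.im| z.re with h | h
    · refine (norm_integral_osc_le_amp hb hz ‖x‖).trans ?_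
      gcongr
      · exact le_max_left _ _
      · linarith
    · have hi : z.im ≠ 0 := by
        intro h0; rw [h0, abs_zero] at h; linarith
      refine (norm_integral_osc_le hb hz hi ‖x‖).trans ?_
      gcongr
      · exact le_max_right _ _
      · linarith
  have hsq : Real.sqrt (s / 4) = Real.sqrt s / 2 := by
    rw [Real.sqrt_div hs0.le, show (4 : ℝ) = 2 ^ 2 by norm_num, Real.sqrt_sq (by norm_num)]
  rw [hsq] at hosc
  have hss := Real.sqrt_pos.2 hs0
  rw [norm_kernel hz0, rpow_three_halves hs0]
  calc 2 * Real.pi / ‖z‖ * ‖∫ r, osc z ‖x‖ r‖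
      ≤ 2 * Real.pi / (s / 2) * (C₁ / (Real.sqrt s / 2)) := by gcongr
    _ = _ := by field_simp

/-- At unit frequency the kernel also decays away from the light cone, where the phase is not
stationary. -/
lemma exists_norm_kernel_one_le : ∃ C : ℝ, 0 < C ∧ ∀ (t : ℝ) (x : E3) (y : ℝ), 0 ≤ y →
    y ≤ |t| + ‖x‖ → ‖kernel (1 - Complex.I * (t : ℂ)) x‖ ≤ C * (1 + y) ^ (-(3 / 2) : ℝ) := by
  obtain ⟨C₀, hC₀, h₀⟩ := exists_norm_kernel_le one_pos
  set C₁ := C₀ * (3 : ℝ)⁻¹ ^ (-(3 / 2) : ℝ)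
  set C₂ := 2 * Real.pi * ((3 + 18) * Real.pi * 4) * (3 : ℝ)⁻¹ ^ (-(3 / 2) : ℝ)
  refine ⟨max C₁ C₂, lt_max_of_lt_left (by positivity), fun t x y hy hyx => ?_⟩
  set z : ℂ := 1 - Complex.I * (t : ℂ) with hz
  have hre : z.re = 1 := by simp [hz]
  have him : z.im = -t := by simp [hz]
  -- either `y` is controlled by `t`, or `‖x‖ > 2 + 2|t|` and the phase is nonstationary
  rcases le_or_gt (1 + y) (3 * (1 + |t|)) with h | h
  · refine (h₀ z hre.ge x).trans ?_
    rw [hre, him, abs_neg]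
    calc C₀ * (1 + |t|) ^ (-(3 / 2) : ℝ) ≤ C₀ * ((3 : ℝ)⁻¹ * (1 + y)) ^ (-(3 / 2) : ℝ) := by
          refine mul_le_mul_of_nonneg_left ?_ hC₀.le
          exact Real.rpow_le_rpow_of_nonpos (by positivity) (by linarith) (by norm_num)
      _ = C₁ * (1 + y) ^ (-(3 / 2) : ℝ) := by
          rw [Real.mul_rpow (by norm_num) (by positivity), mul_assoc]
      _ ≤ _ := by gcongr; exact le_max_left _ _
  · set ρ := ‖x‖ with hρ
    have hρ1 : 2 + 2 * |t| < ρ := by linarith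
    have ht := abs_nonneg t
    have hρ0 : 1 ≤ ρ := by linarith
    have hosc := norm_integral_osc_le_of_nonstationary one_pos hre.ge (by linarith : 0 < ρ)
      (by rw [him, abs_neg]; linarith)
    have hz0 : 0 < ‖z‖ := norm_pos_iff.2 fun h => by rw [h] at hre; simp at hre
    rw [norm_kernel (by rw [hre]; exact one_pos)]
    rw [hre, Real.sqrt_one] at hosc
    calc 2 * Real.pi / ‖z‖ * ‖∫ r, osc z ‖x‖ r‖
        ≤ 2 * Real.pi / ‖z‖ * ((3 + 18 / 1) * Real.pi / 1 * (4 * ‖z‖ / ρ ^ 2)) := by gcongr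
      _ = 2 * Real.pi * ((3 + 18) * Real.pi * 4) * ρ ^ (-(2 : ℕ) : ℝ) := by
          rw [Real.rpow_neg (by linarith), Real.rpow_natCast]
          field_simp
      _ ≤ 2 * Real.pi * ((3 + 18) * Real.pi * 4) * ρ ^ (-(3 / 2) : ℝ) := by
          refine mul_le_mul_of_nonneg_left ?_ (by positivity)
          exact Real.rpow_le_rpow_of_exponent_le hρ0 (by norm_num)
      _ ≤ 2 * Real.pi * ((3 + 18) * Real.pi * 4) * ((3 : ℝ)⁻¹ * (1 + y)) ^ (-(3 / 2) : ℝ) := by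
          refine mul_le_mul_of_nonneg_left ?_ (by positivity)
          exact Real.rpow_le_rpow_of_nonpos (by positivity) (by linarith) (by norm_num)
      _ = C₂ * (1 + y) ^ (-(3 / 2) : ℝ) := by
          rw [Real.mul_rpow (by norm_num) (by positivity), ← mul_assoc]
      _ ≤ _ := by gcongr; exact le_max_right _ _

/-! ### Characters and weights -/

/-- The space-time character `e^{i(x·ξ + t⟨ξ⟩)}`, `p = (t, x)`. -/
noncomputable def wave (p : ℝ × E3) (ξ : E3) : ℂ :=
  Complex.exp (Complex.I * ((inner ℝ p.2 ξ : ℝ) : ℂ)) * flowSymbol p.1 ξ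

lemma wave_eq (p : ℝ × E3) (ξ : E3) :
    wave p ξ = Complex.exp (((inner ℝ p.2 ξ + p.1 * bracket ξ : ℝ) : ℂ) * Complex.I) := by
  rw [wave, flowSymbol, ← Complex.exp_add]
  congr 1
  push_cast
  ring

lemma norm_wave (p : ℝ × E3) (ξ : E3) : ‖wave p ξ‖ = 1 := by
  rw [wave_eq, Complex.norm_exp_ofReal_mul_I]

lemma measurable_wave {α : Type*} [MeasurableSpace α] {p : α → ℝ × E3} {ξ : α → E3}
    (hp : Measurable p) (hξ : Measurable ξ) : Measurable fun a => wave (p a) (ξ a) := by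
  simp only [wave_eq]
  have h1 := hp.fst
  have h2 := hp.snd
  have h3 := continuous_bracket.measurable.comp hξ
  have h4 : Measurable fun a => (inner ℝ (p a).2 (ξ a) : ℝ) := h2.inner hξ
  exact Complex.measurable_exp.comp ((Complex.measurable_ofReal.comp
    (h4.add (h1.mul h3))).mul_const _)

lemma continuous_wave (p : ℝ × E3) : Continuous (wave p) := by
  rw [funext (wave_eq p)]
  fun_prop

lemma wave_mul_conj (p q : ℝ × E3) (ξ : E3) :
    wave p ξ * (starRingEnd ℂ) (wave q ξ) = wave (p - q) ξ := by
  simp only [wave_eq, ← Complex.exp_conj, ← Complex.exp_add, map_mul, Complex.conj_ofReal,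
    Complex.conj_I]
  congr 1
  simp only [Prod.snd_sub, Prod.fst_sub, inner_sub_left]
  push_cast
  ring

/-- The weight `e^{-β(⟨ξ⟩ - 1)}/⟨ξ⟩`, concentrated on `|ξ| ≲ β^{-1/2}` for `β ≳ 1`. -/
noncomputable def ballWeight (β : ℝ) (ξ : E3) : ℝ :=
  Real.exp (-(β * (bracket ξ - 1))) / bracket ξ

/-- The density of the image of the measure `ballWeight 1 ξ dξ` under the Lorentz boost in the
direction `ω` with `sinh` of the rapidity equal to `s`; since `dξ/⟨ξ⟩` is invariant, only the energy in
the exponent changes. For `s = 2^k` it is concentrated on the sector of length `2^k` and width `1` around `2^k ω`. -/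
noncomputable def sectorWeight (s : ℝ) (ω ξ : E3) : ℝ :=
  Real.exp (-(bra s * bracket ξ - s * inner ℝ ω ξ - 1)) / bracket ξ

lemma ballWeight_pos (β : ℝ) (ξ : E3) : 0 < ballWeight β ξ :=
  div_pos (Real.exp_pos _) (by linarith [one_le_bracket ξ])

lemma sectorWeight_pos (s : ℝ) (ω ξ : E3) : 0 < sectorWeight s ω ξ :=
  div_pos (Real.exp_pos _) (by linarith [one_le_bracket ξ])

lemma continuous_ballWeight (β : ℝ) : Continuous (ballWeight β) := by
  have : ∀ ξ, bracket ξ ≠ 0 := fun ξ => by linarith [one_le_bracket ξ]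
  unfold ballWeight
  fun_prop (disch := assumption)

lemma continuous_sectorWeight (s : ℝ) (ω : E3) : Continuous (sectorWeight s ω) := by
  have : ∀ ξ, bracket ξ ≠ 0 := fun ξ => by linarith [one_le_bracket ξ]
  unfold sectorWeight
  fun_prop (disch := assumption)

lemma integrable_ballWeight {β : ℝ} (hβ : 0 < β) : Integrable (ballWeight β) := by
  refine ((integrable_exp_neg_bracket hβ).const_mul (Real.exp β)).mono'
    (continuous_ballWeight β).aestronglyMeasurable (Filter.Eventually.of_forall fun ξ => ?_)
  rw [Real.norm_of_nonneg (ballWeight_pos β ξ).le, ballWeight, ← Real.exp_add]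
  refine (div_le_self (Real.exp_pos _).le (one_le_bracket ξ)).trans (le_of_eq ?_)
  congr 1
  ring

lemma lt_bra (s : ℝ) : s < bra s := by
  have := bra_sq s
  nlinarith [bra_pos s]

/-- The energy in the boosted frame is comparable to `⟨ξ⟩`, with constants depending on `s`. -/
lemma boosted_energy_ge {s : ℝ} (hs : 0 ≤ s) {ω : E3} (hω : ‖ω‖ = 1) (ξ : E3) :
    (bra s - s) * bracket ξ ≤ bra s * bracket ξ - s * inner ℝ ω ξ := by
  have h := real_inner_le_norm ω ξ
  rw [hω, one_mul] at h
  have := norm_le_bracket ξ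
  nlinarith

lemma integrable_sectorWeight {s : ℝ} (hs : 0 ≤ s) {ω : E3} (hω : ‖ω‖ = 1) :
    Integrable (sectorWeight s ω) := by
  refine ((integrable_exp_neg_bracket (sub_pos.2 (lt_bra s))).const_mul (Real.exp 1)).mono'
    (continuous_sectorWeight s ω).aestronglyMeasurable (Filter.Eventually.of_forall fun ξ => ?_)
  rw [Real.norm_of_nonneg (sectorWeight_pos s ω ξ).le, sectorWeight, ← Real.exp_add]
  refine (div_le_self (Real.exp_pos _).le (one_le_bracket ξ)).trans (Real.exp_le_exp.2 ?_)
  linarith [boosted_energy_ge hs hω ξ]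

lemma norm_integral_wave_ballWeight (β t : ℝ) (x : E3) :
    ‖∫ ξ, wave (t, x) ξ * (ballWeight β ξ : ℂ)‖ = ‖kernel (β - Complex.I * (t : ℂ)) x‖ := by
  have h : ∀ ξ, wave (t, x) ξ * (ballWeight β ξ : ℂ) = Complex.exp ((t : ℂ) * Complex.I) *
      (Complex.exp (Complex.I * ((inner ℝ x ξ : ℝ) : ℂ)) *
      (Complex.exp (-(β - Complex.I * (t : ℂ)) * ((bracket ξ - 1 : ℝ) : ℂ))
        / ((bracket ξ : ℝ) : ℂ))) := fun ξ => by
    rw [wave_eq, ballWeight, Complex.ofReal_div, Complex.ofReal_exp, mul_div_assoc', mul_div_assoc',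
      mul_div_assoc', ← Complex.exp_add, ← Complex.exp_add, ← Complex.exp_add]
    congr 2
    push_cast
    ring
  rw [integral_congr_ae (Filter.Eventually.of_forall h), integral_const_mul, norm_mul,
    Complex.norm_exp_ofReal_mul_I, one_mul, kernel]

/-! ### Lorentz boosts -/

lemma integral_comp_sinh {A : ℝ} (hA : 0 < A) (f : ℝ → ℂ) :
    ∫ r, f r = ∫ u, (A * Real.cosh u) • f (A * Real.sinh u) := by
  have h := integral_image_eq_integral_abs_deriv_smul (s := Set.univ)
    (f := fun u => A * Real.sinh u) (f' := fun u => A * Real.cosh u) MeasurableSet.univ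
    (fun u _ => ((Real.hasDerivAt_sinh u).const_mul A).hasDerivWithinAt)
    (fun u _ v _ huv => Real.sinh_injective (mul_left_cancel₀ hA.ne' huv)) f
  have him : (fun u => A * Real.sinh u) '' Set.univ = Set.univ := by
    rw [Set.image_univ, Set.range_eq_univ]
    intro y
    obtain ⟨u, hu⟩ := Real.sinh_surjective (y / A)
    exact ⟨u, by simp only [hu]; field_simp⟩
  rw [him, setIntegral_univ, setIntegral_univ] at h
  rw [h]
  refine integral_congr_ae (Filter.Eventually.of_forall fun u => ?_)
  simp only
  rw [abs_of_pos (mul_pos hA (Real.cosh_pos u))]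

/-- Boost invariance of `dr/⟨r⟩_A`, `⟨r⟩_A = (A² + r²)^{1/2}`: in the coordinate `r = A sinh u` it is
translation invariance. -/
lemma integral_boost_line {A : ℝ} (hA : 0 < A) (s : ℝ) (G : ℝ → ℝ → ℂ) :
    ∫ r, G (Real.sqrt (A ^ 2 + r ^ 2)) r / ((Real.sqrt (A ^ 2 + r ^ 2) : ℝ) : ℂ)
      = ∫ r, G (bra s * Real.sqrt (A ^ 2 + r ^ 2) + s * r) (s * Real.sqrt (A ^ 2 + r ^ 2) + bra s * r)
          / ((Real.sqrt (A ^ 2 + r ^ 2) : ℝ) : ℂ) := by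
  have hE : ∀ u, Real.sqrt (A ^ 2 + (A * Real.sinh u) ^ 2) = A * Real.cosh u := fun u => by
    rw [← Real.sqrt_sq (mul_pos hA (Real.cosh_pos u)).le]
    congr 1
    rw [mul_pow, mul_pow, Real.cosh_sq]
    ring
  have hne : ∀ u, ((A * Real.cosh u : ℝ) : ℂ) ≠ 0 := fun u =>
    Complex.ofReal_ne_zero.2 (mul_pos hA (Real.cosh_pos u)).ne'
  have hc : Real.cosh (Real.arsinh s) = bra s := Real.cosh_arsinh s
  refine (integral_comp_sinh hA _).trans (Eq.trans ?_ (integral_comp_sinh hA _).symm)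
  rw [← integral_add_right_eq_self _ (Real.arsinh s)]
  refine integral_congr_ae (Filter.Eventually.of_forall fun u => ?_)
  simp only [hE, Complex.real_smul]
  rw [mul_div_cancel₀ _ (hne _), mul_div_cancel₀ _ (hne _), Real.cosh_add, Real.sinh_add, hc,
    Real.sinh_arsinh]
  congr 1 <;> ring

/-- The kernel of a sector is the kernel at unit frequency, evaluated at the boosted point. -/
lemma norm_integral_wave_sectorWeight {s : ℝ} (hs : 0 ≤ s) {ω : E3} (hω : ‖ω‖ = 1) (t : ℝ)
    (x : E3) :
    ‖∫ ξ, wave (t, x) ξ * (sectorWeight s ω ξ : ℂ)‖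
      = ‖kernel (1 - Complex.I * ((bra s * t + s * inner ℝ ω x : ℝ) : ℂ))
          (x + (s * t + (bra s - 1) * inner ℝ ω x) • ω)‖ := by
  obtain ⟨b, hb⟩ := exists_orthonormalBasis_smul ω
  rw [hω, one_smul] at hb
  subst hb
  set t' := bra s * t + s * inner ℝ (b 0) x with ht'
  set x' := x + (s * t + (bra s - 1) * inner ℝ (b 0) x) • b 0 with hx'
  have hx'c : coords b x' = (s * t + bra s * (coords b x).1, (coords b x).2.1, (coords b x).2.2) := by
    simp only [coords, hx', inner_add_right, inner_smul_right]
    have h01 : inner ℝ (b 1) (b 0) = 0 := b.inner_eq_zero (by decide)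
    have h02 : inner ℝ (b 2) (b 0) = 0 := b.inner_eq_zero (by decide)
    have h00 : inner ℝ (b 0) (b 0) = 1 := b.inner_eq_one 0
    rw [h01, h02, h00]
    refine Prod.ext (by simp only; ring) (Prod.ext (by simp) (by simp))
  have hk := norm_integral_wave_ballWeight 1 t' x'
  rw [Complex.ofReal_one] at hk
  rw [← hk]
  congr 1
  set c := coords b x with hc
  -- both integrands, in coordinates
  set Ψ : ℝ × ℝ × ℝ → ℂ := fun p => Complex.exp ((c.1 * p.1 + c.2.1 * p.2.1 + c.2.2 * p.2.2
    + t * bra3 p : ℝ) * Complex.I) * (Real.exp (-(bra s * bra3 p - s * p.1 - 1)) / bra3 p : ℝ) with hΨ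
  set Ψ' : ℝ × ℝ × ℝ → ℂ := fun p => Complex.exp (((s * t + bra s * c.1) * p.1 + c.2.1 * p.2.1
    + c.2.2 * p.2.2 + t' * bra3 p : ℝ) * Complex.I) * (Real.exp (-(1 * (bra3 p - 1))) / bra3 p : ℝ)
    with hΨ'
  have e1 : ∀ ξ, wave (t, x) ξ * (sectorWeight s (b 0) ξ : ℂ) = Ψ (coords b ξ) := fun ξ => by
    rw [wave_eq, sectorWeight, inner_eq_coords b x ξ, bracket_eq_bra3 b]
    rfl
  have e2 : ∀ ξ, wave (t', x') ξ * (ballWeight 1 ξ : ℂ) = Ψ' (coords b ξ) := fun ξ => by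
    rw [wave_eq, ballWeight, inner_eq_coords b x' ξ, bracket_eq_bra3 b, hx'c]
  have i1 : Integrable Ψ := by
    rw [← integrable_comp_coords b]
    refine Integrable.congr ?_ (Filter.Eventually.of_forall e1)
    refine ((integrable_sectorWeight hs hω).ofReal (𝕜 := ℂ)).bdd_mul (c := 1)
      (continuous_wave _).aestronglyMeasurable
      (Filter.Eventually.of_forall fun ξ => (norm_wave _ ξ).le)
  have i2 : Integrable Ψ' := by
    rw [← integrable_comp_coords b]
    refine Integrable.congr ?_ (Filter.Eventually.of_forall e2)
    refine ((integrable_ballWeight one_pos).ofReal (𝕜 := ℂ)).bdd_mul (c := 1)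
      (continuous_wave _).aestronglyMeasurable
      (Filter.Eventually.of_forall fun ξ => (norm_wave _ ξ).le)
  rw [integral_congr_ae (Filter.Eventually.of_forall e1),
    integral_congr_ae (Filter.Eventually.of_forall e2), integral_comp_coords, integral_comp_coords,
    Measure.volume_eq_prod, integral_prod_symm _ i1, integral_prod_symm _ i2]
  refine integral_congr_ae (Filter.Eventually.of_forall fun y => ?_)
  set A := Real.sqrt (1 + (y.1 ^ 2 + y.2 ^ 2)) with hA
  have hA0 : 0 < A := Real.sqrt_pos.2 (by positivity)
  have hbr : ∀ r, bra3 (r, y) = Real.sqrt (A ^ 2 + r ^ 2) := fun r => by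
    rw [hA, Real.sq_sqrt (by positivity), bra3, sqNorm]
    congr 1
    ring
  set G : ℝ → ℝ → ℂ := fun E r => Complex.exp ((c.1 * r + c.2.1 * y.1 + c.2.2 * y.2
    + t * E : ℝ) * Complex.I) * (Real.exp (-(bra s * E - s * r - 1)) : ℝ) with hG
  refine Eq.trans ?_ ((integral_boost_line hA0 s G).trans ?_)
  · refine integral_congr_ae (Filter.Eventually.of_forall fun r => ?_)
    simp only [hΨ, hG, hbr]
    rw [Complex.ofReal_div, mul_div_assoc']
  · refine integral_congr_ae (Filter.Eventually.of_forall fun r => ?_)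
    simp only [hΨ', hG, hbr]
    rw [Complex.ofReal_div, mul_div_assoc']
    have hs2 := bra_sq s
    set E := Real.sqrt (A ^ 2 + r ^ 2)
    have hc1 : inner ℝ (b 0) x = c.1 := rfl
    congr 3
    · rw [ht', hc1]
      congr 2
      ring
    · congr 1
      linear_combination (-E) * hs2

/-! ### The `TT*` argument -/

/-- The superposition `∫ e^{i(x·ξ + t⟨ξ⟩)} g(ξ) dξ` of characters, at the space-time point `p`. -/
noncomputable def synth (g : E3 → ℂ) (p : ℝ × E3) : ℂ := ∫ ξ, wave p ξ * g ξ

lemma integrable_wave_mul {g : E3 → ℂ} (hg : Integrable g) (p : ℝ × E3) :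
    Integrable (fun ξ => wave p ξ * g ξ) :=
  hg.bdd_mul (c := 1) (continuous_wave p).aestronglyMeasurable
    (Filter.Eventually.of_forall fun ξ => (norm_wave p ξ).le)

lemma continuous_synth {g : E3 → ℂ} (hg : Integrable g) : Continuous (synth g) := by
  refine continuous_of_dominated (bound := fun ξ => ‖g ξ‖)
    (fun p => (integrable_wave_mul hg p).aestronglyMeasurable)
    (fun p => Filter.Eventually.of_forall fun ξ => by rw [norm_mul, norm_wave, one_mul]) hg.norm
    (Filter.Eventually.of_forall fun ξ => ?_)
  simp only [wave_eq]
  fun_prop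

lemma norm_synth_le (g : E3 → ℂ) (p : ℝ × E3) : ‖synth g p‖ ≤ ∫ ξ, ‖g ξ‖ := by
  refine (norm_integral_le_integral_norm _).trans_eq ?_
  simp only [norm_mul, norm_wave, one_mul]

/-- The quadratic form bound: the operator with kernel `K(p t, p s)` is bounded on `L²` by
Schur's test, if `K(p t, p s)` is dominated by `k(t - s)`. -/
lemma integral_weight_mul_sq_le {w : E3 → ℝ} (hw : Integrable w)
    {μ : Measure ℝ} [IsFiniteMeasure μ] (hμ : μ ≤ volume) {u : ℝ → ℂ} (hu : Measurable u) {B : ℝ}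
    (huB : ∀ t, ‖u t‖ ≤ B) {p : ℝ → ℝ × E3} (hp : Measurable p) {k : ℝ → ℝ} (hk : Integrable k)
    (hkm : Measurable k) (hk0 : ∀ t, 0 ≤ k t) {B' : ℝ} (hkB : ∀ t, k t ≤ B')
    (hK : ∀ t s, ‖∫ ξ, wave (p t - p s) ξ * (w ξ : ℂ)‖ ≤ k (t - s)) :
    ∫ ξ, w ξ * ‖∫ t, (starRingEnd ℂ) (u t) * wave (p t) ξ ∂μ‖ ^ 2 ≤ (∫ t, k t) * ∫ t, ‖u t‖ ^ 2 ∂μ := by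
  have hB : 0 ≤ B := (norm_nonneg _).trans (huB 0)
  set Φ : (ℝ × ℝ) → E3 → ℂ := fun z ξ =>
    ((starRingEnd ℂ) (u z.1) * u z.2) * wave (p z.1 - p z.2) ξ with hΦ
  have hΦB : ∀ z ξ, ‖Φ z ξ‖ ≤ B * B := fun z ξ => by
    rw [hΦ, norm_mul, norm_mul, RCLike.norm_conj, norm_wave, mul_one]
    gcongr <;> exact huB _
  have hΦm : Measurable (fun q : (ℝ × ℝ) × E3 => Φ q.1 q.2) := by
    refine Measurable.mul ?_ ?_
    · exact (Complex.continuous_conj.measurable.comp (hu.comp (measurable_fst.comp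
        measurable_fst))).mul (hu.comp (measurable_snd.comp measurable_fst))
    · have h1 : Measurable fun q : (ℝ × ℝ) × E3 => p q.1.1 - p q.1.2 :=
        (hp.comp (measurable_fst.comp measurable_fst)).sub
          (hp.comp (measurable_snd.comp measurable_fst))
      exact measurable_wave h1 measurable_snd
  have e1 : ∀ ξ, ((w ξ * ‖∫ t, (starRingEnd ℂ) (u t) * wave (p t) ξ ∂μ‖ ^ 2 : ℝ) : ℂ)
      = ∫ z, Φ z ξ * (w ξ : ℂ) ∂(μ.prod μ) := fun ξ => by
    rw [integral_mul_const, Complex.ofReal_mul, mul_comm, ← Complex.normSq_eq_norm_sq,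
      ← Complex.mul_conj, ← integral_conj, ← integral_prod_mul]
    congr 1
    refine integral_congr_ae (Filter.Eventually.of_forall fun z => ?_)
    simp only [hΦ, ← wave_mul_conj, map_mul, Complex.conj_conj]
    ring
  have hint : Integrable (fun q : E3 × (ℝ × ℝ) => Φ q.2 q.1 * (w q.1 : ℂ))
      (volume.prod (μ.prod μ)) := by
    refine Integrable.bdd_mul (c := B * B) ?_ ?_ (Filter.Eventually.of_forall fun q => hΦB _ _)
    · have := (hw.ofReal (𝕜 := ℂ)).mul_prod (integrable_const (1 : ℂ) (μ := μ.prod μ))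
      simpa using this
    · exact (hΦm.comp measurable_swap).aestronglyMeasurable
  have e2 : ((∫ ξ, w ξ * ‖∫ t, (starRingEnd ℂ) (u t) * wave (p t) ξ ∂μ‖ ^ 2 : ℝ) : ℂ)
      = ∫ z, (∫ ξ, Φ z ξ * (w ξ : ℂ)) ∂(μ.prod μ) := by
    rw [← integral_complex_ofReal, integral_congr_ae (Filter.Eventually.of_forall e1)]
    exact integral_integral_swap hint
  have e3 : ∀ z, ‖∫ ξ, Φ z ξ * (w ξ : ℂ)‖
      ≤ (‖u z.1‖ ^ 2 * k (z.1 - z.2) + ‖u z.2‖ ^ 2 * k (z.1 - z.2)) / 2 := fun z => by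
    have : ∀ ξ, Φ z ξ * (w ξ : ℂ) = ((starRingEnd ℂ) (u z.1) * u z.2) *
      (wave (p z.1 - p z.2) ξ * (w ξ : ℂ)) := fun ξ => by rw [hΦ]; ring
    rw [integral_congr_ae (Filter.Eventually.of_forall this), integral_const_mul, norm_mul,
      norm_mul, RCLike.norm_conj]
    have h1 : ‖u z.1‖ * ‖u z.2‖ ≤ (‖u z.1‖ ^ 2 + ‖u z.2‖ ^ 2) / 2 := by
      nlinarith [sq_nonneg (‖u z.1‖ - ‖u z.2‖)]
    calc ‖u z.1‖ * ‖u z.2‖ * ‖∫ ξ, wave (p z.1 - p z.2) ξ * (w ξ : ℂ)‖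
        ≤ (‖u z.1‖ ^ 2 + ‖u z.2‖ ^ 2) / 2 * k (z.1 - z.2) := by
          gcongr; exact hK _ _
      _ = _ := by ring
  have hum : Measurable (fun t => ‖u t‖ ^ 2) := hu.norm.pow_const 2
  have hkz : Measurable (fun z : ℝ × ℝ => k (z.1 - z.2)) :=
    hkm.comp (measurable_fst.sub measurable_snd)
  have huk : ∀ t s, ‖‖u t‖ ^ 2 * k s‖ ≤ B ^ 2 * B' := fun t s => by
    rw [Real.norm_of_nonneg (mul_nonneg (sq_nonneg _) (hk0 s))]
    have := hk0 s
    gcongr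
    · exact huB t
    · exact hkB s
  have i1 : Integrable (fun z : ℝ × ℝ => ‖u z.1‖ ^ 2 * k (z.1 - z.2)) (μ.prod μ) :=
    Integrable.of_bound ((hum.comp measurable_fst).mul hkz).aestronglyMeasurable _
      (Filter.Eventually.of_forall fun z => huk _ _)
  have i2 : Integrable (fun z : ℝ × ℝ => ‖u z.2‖ ^ 2 * k (z.1 - z.2)) (μ.prod μ) :=
    Integrable.of_bound ((hum.comp measurable_snd).mul hkz).aestronglyMeasurable _
      (Filter.Eventually.of_forall fun z => huk _ _)
  have hu2 : Integrable (fun t => ‖u t‖ ^ 2) μ :=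
    Integrable.of_bound hum.aestronglyMeasurable (B ^ 2) (Filter.Eventually.of_forall fun t => by
      rw [Real.norm_of_nonneg (sq_nonneg _)]; gcongr; exact huB t)
  have j1 : ∫ z, ‖u z.1‖ ^ 2 * k (z.1 - z.2) ∂(μ.prod μ) ≤ (∫ t, k t) * ∫ t, ‖u t‖ ^ 2 ∂μ := by
    rw [integral_prod _ i1, ← integral_const_mul]
    refine integral_mono i1.integral_prod_left (hu2.const_mul _) fun t => ?_
    simp only
    rw [integral_const_mul, mul_comm]
    gcongr
    refine (integral_mono_measure hμ (Filter.Eventually.of_forall fun s => hk0 _)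
      (hk.comp_sub_left t)).trans_eq ?_
    exact integral_sub_left_eq_self k volume t
  have j2 : ∫ z, ‖u z.2‖ ^ 2 * k (z.1 - z.2) ∂(μ.prod μ) ≤ (∫ t, k t) * ∫ t, ‖u t‖ ^ 2 ∂μ := by
    rw [integral_prod_symm _ i2, ← integral_const_mul]
    refine integral_mono i2.integral_prod_right (hu2.const_mul _) fun t => ?_
    simp only
    rw [integral_const_mul, mul_comm]
    gcongr
    refine (integral_mono_measure hμ (Filter.Eventually.of_forall fun s => hk0 _)
      (hk.comp_sub_right t)).trans_eq ?_
    exact integral_sub_right_eq_self k t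
  calc ∫ ξ, w ξ * ‖∫ t, (starRingEnd ℂ) (u t) * wave (p t) ξ ∂μ‖ ^ 2
      ≤ ‖((∫ ξ, w ξ * ‖∫ t, (starRingEnd ℂ) (u t) * wave (p t) ξ ∂μ‖ ^ 2 : ℝ) : ℂ)‖ := by
        rw [Complex.norm_real]; exact le_abs_self _
    _ = ‖∫ z, (∫ ξ, Φ z ξ * (w ξ : ℂ)) ∂(μ.prod μ)‖ := by rw [e2]
    _ ≤ ∫ z, (‖u z.1‖ ^ 2 * k (z.1 - z.2) + ‖u z.2‖ ^ 2 * k (z.1 - z.2)) / 2 ∂(μ.prod μ) :=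
        norm_integral_le_of_norm_le ((i1.add i2).div_const 2) (Filter.Eventually.of_forall e3)
    _ ≤ _ := by
        rw [integral_div, integral_add i1 i2]
        linarith

/-- The linearized estimate: along a measurable choice `t ↦ p t` of space-time points, the operator
`g ↦ synth g ∘ p` is bounded on `L²`. By duality and the inequality between the means,
`∫ |u|² = ∫ g G ≤ ½ (A/c) ∫ |g|² + ½ A⁻¹ ∫ w |G|²`, and the last term is at most `½ ∫ |u|²`. -/
lemma integral_norm_synth_sq_le {w : E3 → ℝ} (hw : Integrable w) (hw0 : ∀ ξ, 0 ≤ w ξ)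
    {c : ℝ} (hc : 0 < c) {g : E3 → ℂ} (hg : Integrable g) (hg2 : Integrable (fun ξ => ‖g ξ‖ ^ 2))
    (hgw : ∀ᵐ ξ, g ξ ≠ 0 → c ≤ w ξ)
    {μ : Measure ℝ} [IsFiniteMeasure μ] (hμ : μ ≤ volume)
    {p : ℝ → ℝ × E3} (hp : Measurable p) {k : ℝ → ℝ} (hk : Integrable k)
    (hkm : Measurable k) (hk0 : ∀ t, 0 ≤ k t) {B' : ℝ} (hkB : ∀ t, k t ≤ B')
    (hK : ∀ t s, ‖∫ ξ, wave (p t - p s) ξ * (w ξ : ℂ)‖ ≤ k (t - s))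
    {A : ℝ} (hA : 0 < A) (hkA : ∫ t, k t ≤ A) :
    ∫ t, ‖synth g (p t)‖ ^ 2 ∂μ ≤ A / c * ∫ ξ, ‖g ξ‖ ^ 2 := by
  set u : ℝ → ℂ := fun t => synth g (p t) with hu
  have hum : Measurable u := (continuous_synth hg).measurable.comp hp
  set B := ∫ ξ, ‖g ξ‖ with hB
  have huB : ∀ t, ‖u t‖ ≤ B := fun t => norm_synth_le g _
  set G : E3 → ℂ := fun ξ => ∫ t, (starRingEnd ℂ) (u t) * wave (p t) ξ ∂μ with hG
  have hquad := integral_weight_mul_sq_le hw hμ hum huB hp hk hkm hk0 hkB hK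
  set J := ∫ t, ‖u t‖ ^ 2 ∂μ with hJ
  have hJ0 : 0 ≤ J := integral_nonneg fun t => sq_nonneg _
  have hquad' : ∫ ξ, w ξ * ‖G ξ‖ ^ 2 ≤ A * J := hquad.trans (by gcongr)
  have hmeas : Measurable (fun q : ℝ × E3 => (starRingEnd ℂ) (u q.1) * wave (p q.1) q.2) :=
    (Complex.continuous_conj.measurable.comp (hum.comp measurable_fst)).mul
      (measurable_wave (hp.comp measurable_fst) measurable_snd)
  have hbd : ∀ t ξ, ‖(starRingEnd ℂ) (u t) * wave (p t) ξ‖ ≤ B := fun t ξ => by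
    rw [norm_mul, norm_wave, RCLike.norm_conj, mul_one]
    exact huB t
  have hGm : StronglyMeasurable G :=
    (hmeas.comp measurable_swap).stronglyMeasurable.integral_prod_right'
  have hGB : ∀ ξ, ‖G ξ‖ ≤ B * μ.real Set.univ := fun ξ =>
    norm_integral_le_of_norm_le_const (Filter.Eventually.of_forall fun t => hbd t ξ)
  have hint : Integrable (fun q : ℝ × E3 => ((starRingEnd ℂ) (u q.1) * wave (p q.1) q.2) * g q.2)
      (μ.prod volume) := by
    refine Integrable.bdd_mul (c := B) ?_ hmeas.aestronglyMeasurable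
      (Filter.Eventually.of_forall fun q => hbd _ _)
    have := (integrable_const (1 : ℂ) (μ := μ)).mul_prod hg
    simpa using this
  have hdual : (J : ℂ) = ∫ ξ, G ξ * g ξ := by
    have e1 : ∀ t, ((‖u t‖ ^ 2 : ℝ) : ℂ)
        = ∫ ξ, ((starRingEnd ℂ) (u t) * wave (p t) ξ) * g ξ := fun t => by
      rw [← Complex.normSq_eq_norm_sq, ← Complex.mul_conj, mul_comm]
      conv_lhs => rw [hu]
      simp only [synth, mul_assoc, integral_const_mul]
      rfl
    rw [hJ, ← integral_complex_ofReal, integral_congr_ae (Filter.Eventually.of_forall e1),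
      integral_integral_swap hint]
    simp only [hG, integral_mul_const]
  have hwG : Integrable (fun ξ => w ξ * ‖G ξ‖ ^ 2) := by
    refine hw.mul_bdd (c := (B * μ.real Set.univ) ^ 2) (hGm.norm.pow 2).aestronglyMeasurable
      (Filter.Eventually.of_forall fun ξ => ?_)
    rw [Real.norm_of_nonneg (sq_nonneg _)]
    gcongr
    exact hGB ξ
  have hpt : ∀ᵐ ξ, ‖G ξ * g ξ‖ ≤ (A / c * ‖g ξ‖ ^ 2 + A⁻¹ * (w ξ * ‖G ξ‖ ^ 2)) / 2 := by
    filter_upwards [hgw] with ξ hξ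
    by_cases h0 : g ξ = 0
    · rw [h0, mul_zero, norm_zero]
      have := hw0 ξ
      positivity
    · have hcw := hξ h0
      rw [norm_mul]
      have h1 : 2 * (‖G ξ‖ * ‖g ξ‖) ≤ A / c * ‖g ξ‖ ^ 2 + A⁻¹ * (c * ‖G ξ‖ ^ 2) := by
        have h2 := sq_nonneg (A * ‖g ξ‖ - c * ‖G ξ‖)
        have h3 : A / c * ‖g ξ‖ ^ 2 + A⁻¹ * (c * ‖G ξ‖ ^ 2)
            = ((A * ‖g ξ‖) ^ 2 + (c * ‖G ξ‖) ^ 2) / (A * c) := by field_simp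
        rw [h3, le_div_iff₀ (by positivity)]
        nlinarith
      have h4 : A⁻¹ * (c * ‖G ξ‖ ^ 2) ≤ A⁻¹ * (w ξ * ‖G ξ‖ ^ 2) := by gcongr
      linarith
  have hfin : J ≤ (A / c * (∫ ξ, ‖g ξ‖ ^ 2) + A⁻¹ * ∫ ξ, w ξ * ‖G ξ‖ ^ 2) / 2 := by
    calc J ≤ ‖(J : ℂ)‖ := by rw [Complex.norm_real]; exact le_abs_self _
      _ = ‖∫ ξ, G ξ * g ξ‖ := by rw [hdual]
      _ ≤ ∫ ξ, (A / c * ‖g ξ‖ ^ 2 + A⁻¹ * (w ξ * ‖G ξ‖ ^ 2)) / 2 :=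
          norm_integral_le_of_norm_le (((hg2.const_mul _).add (hwG.const_mul _)).div_const 2) hpt
      _ = _ := by
          rw [integral_div, integral_add (hg2.const_mul _) (hwG.const_mul _), integral_const_mul,
            integral_const_mul]
  have hlast : A⁻¹ * ∫ ξ, w ξ * ‖G ξ‖ ^ 2 ≤ J := by
    rw [inv_mul_le_iff₀ hA]
    exact hquad'
  linarith

/-- Measurable choice of points where the supremum over a sequence is asymptotically attained. -/
lemma exists_measurable_maximizers {α : Type*} [MeasurableSpace α] {v : α × E3 → ℝ}
    (hv : Measurable v) (a : ℕ → E3) : ∃ X : ℕ → α → E3, (∀ n, Measurable (X n)) ∧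
      (∀ t, Monotone fun n => v (t, X n t)) ∧ ∀ n t, v (t, a n) ≤ v (t, X n t) := by
  classical
  let X : ℕ → α → E3 := fun n => Nat.rec (fun _ => a 0)
    (fun m Y t => if v (t, Y t) ≤ v (t, a (m + 1)) then a (m + 1) else Y t) n
  have hX : ∀ n t, X (n + 1) t = if v (t, X n t) ≤ v (t, a (n + 1)) then a (n + 1) else X n t :=
    fun n t => rfl
  refine ⟨X, fun n => ?_, fun t => monotone_nat_of_le_succ fun n => ?_, fun n t => ?_⟩
  · induction n with
    | zero => exact measurable_const
    | succ n ih =>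
      have : X (n + 1) = fun t => if v (t, X n t) ≤ v (t, a (n + 1)) then a (n + 1) else X n t :=
        funext (hX n)
      rw [this]
      exact Measurable.ite (measurableSet_le (hv.comp (measurable_id.prodMk ih))
        (hv.comp (measurable_id.prodMk measurable_const))) measurable_const ih
  · rw [hX]
    split_ifs with h
    · exact h
    · exact le_rfl
  · cases n with
    | zero => exact le_rfl
    | succ n =>
      rw [hX]
      split_ifs with h
      · exact le_rfl
      · exact (not_le.1 h).le

/-- The `TT*` principle for `L²_t L^∞_x`, in the coordinates given by an additive map `L`: the kernel
`∫ e^{i(x·ξ + t⟨ξ⟩)} w(ξ) dξ` may be taken with any weight `w` that is bounded below by `c` on the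
support of `g`. -/
theorem mixedNorm_synth_le {w : E3 → ℝ} (hw : Integrable w) (hw0 : ∀ ξ, 0 ≤ w ξ)
    {c : ℝ} (hc : 0 < c) {g : E3 → ℂ} (hg : Integrable g) (hg2 : Integrable (fun ξ => ‖g ξ‖ ^ 2))
    (hgw : ∀ᵐ ξ, g ξ ≠ 0 → c ≤ w ξ)
    {L : ℝ × E3 → ℝ × E3} (hL : Continuous L) (hLsub : ∀ p q, L (p - q) = L p - L q)
    {k : ℝ → ℝ} (hk : Integrable k) (hkm : Measurable k) (hk0 : ∀ t, 0 ≤ k t) {B' : ℝ}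
    (hkB : ∀ t, k t ≤ B')
    (hK : ∀ t x, ‖∫ ξ, wave (L (t, x)) ξ * (w ξ : ℂ)‖ ≤ k t)
    {A : ℝ} (hA : 0 < A) (hkA : ∫ t, k t ≤ A) :
    mixedNorm 2 ⊤ (fun p => synth g (L p))
      ≤ ENNReal.ofReal (Real.sqrt (A / c * ∫ ξ, ‖g ξ‖ ^ 2)) := by
  have hv : Continuous fun p => synth g (L p) := (continuous_synth hg).comp hL
  set D := A / c * ∫ ξ, ‖g ξ‖ ^ 2 with hD
  have hD0 : 0 ≤ D := mul_nonneg (by positivity) (integral_nonneg fun _ => sq_nonneg _)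
  obtain ⟨X, hXm, hXmono, hXmax⟩ := exists_measurable_maximizers hv.norm.measurable
    (TopologicalSpace.denseSeq E3)
  set F : ℕ → ℝ → ℝ≥0∞ := fun n => (Set.Icc (-(n : ℝ)) n).indicator
    fun t => ENNReal.ofReal (‖synth g (L (t, X n t))‖ ^ 2) with hF
  have hpm : ∀ n, Measurable fun t => L (t, X n t) := fun n =>
    hL.measurable.comp (measurable_id.prodMk (hXm n))
  have hFm : ∀ n, Measurable (F n) := fun n => by
    refine Measurable.indicator (ENNReal.measurable_ofReal.comp ?_) measurableSet_Icc
    exact (((continuous_synth hg).measurable.comp (hpm n)).norm).pow_const 2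
  have hFmono : Monotone F := fun m n hmn t => by
    have hmn' : (m : ℝ) ≤ n := Nat.cast_le.2 hmn
    by_cases h : t ∈ Set.Icc (-(m : ℝ)) m
    · have h' : t ∈ Set.Icc (-(n : ℝ)) n := ⟨by linarith [h.1], h.2.trans hmn'⟩
      simp only [hF, Set.indicator_of_mem h, Set.indicator_of_mem h']
      refine ENNReal.ofReal_le_ofReal ?_
      gcongr
      exact hXmono t hmn
    · simp only [hF, Set.indicator_of_notMem h]
      exact zero_le
  have hFle : ∀ n, ∫⁻ t, F n t ≤ ENNReal.ofReal D := fun n => by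
    rw [hF, lintegral_indicator measurableSet_Icc, ← ofReal_integral_eq_lintegral_ofReal]
    · refine ENNReal.ofReal_le_ofReal ?_
      refine integral_norm_synth_sq_le hw hw0 hc hg hg2 hgw Measure.restrict_le_self (hpm n) hk hkm
        hk0 hkB (fun t s => ?_) hA hkA
      rw [← hLsub]
      exact hK _ _
    · refine Integrable.of_bound (((continuous_synth hg).measurable.comp
        (hpm n)).norm.pow_const 2).aestronglyMeasurable ((∫ ξ, ‖g ξ‖) ^ 2)
        (Filter.Eventually.of_forall fun t => ?_)
      rw [Real.norm_of_nonneg (sq_nonneg _)]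
      gcongr
      exact norm_synth_le g _
    · exact Filter.Eventually.of_forall fun t => sq_nonneg _
  have hsup : ∫⁻ t, ⨆ n, F n t ≤ ENNReal.ofReal D := by
    rw [lintegral_iSup hFm hFmono]
    exact iSup_le hFle
  have hpt : ∀ t, eLpNorm (fun x => synth g (L (t, x))) ⊤ volume ^ (2 : ℝ) ≤ ⨆ n, F n t := fun t => by
    have h1 : ∀ n, ENNReal.ofReal (‖synth g (L (t, TopologicalSpace.denseSeq E3 n))‖ ^ 2)
        ≤ ⨆ n, F n t := fun n => by
      obtain ⟨N, hN⟩ := exists_nat_ge |t|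
      refine le_trans ?_ (le_iSup (fun n => F n t) (max n N))
      have hmem : t ∈ Set.Icc (-((max n N : ℕ) : ℝ)) (max n N : ℕ) := by
        have : (N : ℝ) ≤ (max n N : ℕ) := Nat.cast_le.2 (le_max_right _ _)
        exact abs_le.1 (hN.trans this)
      simp only [hF, Set.indicator_of_mem hmem]
      refine ENNReal.ofReal_le_ofReal ?_
      gcongr
      exact (hXmax n t).trans (hXmono t (le_max_left _ _))
    have h2 : ∀ x, ENNReal.ofReal (‖synth g (L (t, x))‖ ^ 2) ≤ ⨆ n, F n t := fun x => by
      refine (TopologicalSpace.denseRange_denseSeq E3).induction_on x ?_ h1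
      refine isClosed_le (ENNReal.continuous_ofReal.comp ?_) continuous_const
      exact (hv.comp (Continuous.prodMk_right t)).norm.pow 2
    have h3 : ∀ x, ‖synth g (L (t, x))‖ₑ ≤ (⨆ n, F n t) ^ (2 : ℝ)⁻¹ := fun x => by
      rw [ENNReal.le_rpow_inv_iff (by norm_num), ← ofReal_norm,
        ENNReal.ofReal_rpow_of_nonneg (norm_nonneg _) (by norm_num), Real.rpow_two]
      exact h2 x
    rw [← ENNReal.le_rpow_inv_iff (by norm_num), eLpNorm_exponent_top]
    exact eLpNormEssSup_le_of_ae_enorm_bound (Filter.Eventually.of_forall h3)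
  rw [mixedNorm, eLpNorm_eq_lintegral_rpow_enorm_toReal (by norm_num) (by norm_num)]
  simp only [enorm_eq_self, ENNReal.toReal_ofNat]
  rw [Real.sqrt_eq_rpow, ← ENNReal.ofReal_rpow_of_nonneg hD0 (by norm_num)]
  gcongr
  exact (lintegral_mono hpt).trans hsup

/-! ### The Fourier side -/

lemma integral_norm_sq_eq (f : L2) : ∫ x, ‖f x‖ ^ 2 = ‖f‖ ^ 2 := by
  have h : ((‖f‖ ^ 2 : ℝ) : ℂ) = inner ℂ f f := by
    rw [inner_self_eq_norm_sq_to_K]; norm_cast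
  rw [L2.inner_def] at h
  have e : ∀ x, inner ℂ (f x) (f x) = ((‖f x‖ ^ 2 : ℝ) : ℂ) := fun x => by
    rw [inner_self_eq_norm_sq_to_K]; norm_cast
  simp only [e] at h
  rw [integral_complex_ofReal] at h
  exact_mod_cast h.symm

lemma integrable_norm_hat_sq (f : L2) : Integrable (fun ξ => ‖hat f ξ‖ ^ 2) :=
  ((Lp.memLp (𝓕 f : L2)).integrable_norm_pow two_ne_zero).comp_smul
    (inv_ne_zero (by positivity : (2 * Real.pi) ≠ 0))

lemma integral_norm_hat_sq (f : L2) : ∫ ξ, ‖hat f ξ‖ ^ 2 = (2 * Real.pi) ^ 3 * ‖f‖ ^ 2 := by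
  have h := Measure.integral_comp_smul (volume : Measure E3) (fun v => ‖(𝓕 f : L2) v‖ ^ 2)
    (2 * Real.pi)⁻¹
  rw [finrank_euclideanSpace_fin, integral_norm_sq_eq, Lp.norm_fourier_eq] at h
  simp only [hat]
  rw [h, inv_pow, inv_inv, abs_of_pos (by positivity), smul_eq_mul]

lemma integrable_hat {f : L2} {S : Set E3} (hS : Bornology.IsBounded S)
    (hf : FourierSupportedIn f S) : Integrable (hat f) :=
  (integrable_of_fourierSupportedIn hS hf).comp_smul
    (inv_ne_zero (by positivity : (2 * Real.pi) ≠ 0))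

lemma FourierSupportedIn.mono {f : L2} {S T : Set E3} (hf : FourierSupportedIn f S) (h : S ⊆ T) :
    FourierSupportedIn f T := by
  filter_upwards [hf] with ξ hξ hT
  exact hξ fun hS => hT (h hS)

lemma freeWave_eq_synth (f : L2) :
    freeWave f = synth (fun ξ => (((2 * Real.pi) ^ 3)⁻¹ : ℝ) • hat f ξ) := by
  ext p
  simp only [synth, mul_smul_comm, integral_smul]
  rfl

/-- The `TT*` principle for the free wave of data with bounded frequency support. -/
lemma mixedNorm_freeWave_le {w : E3 → ℝ} (hw : Integrable w) (hw0 : ∀ ξ, 0 ≤ w ξ)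
    {S : Set E3} (hS : Bornology.IsBounded S) {c : ℝ} (hc : 0 < c) (hcw : ∀ ξ ∈ S, c ≤ w ξ)
    {f : L2} (hf : FourierSupportedIn f S)
    {L : ℝ × E3 → ℝ × E3} (hL : Continuous L) (hLsub : ∀ p q, L (p - q) = L p - L q)
    {k : ℝ → ℝ} (hk : Integrable k) (hkm : Measurable k) (hk0 : ∀ t, 0 ≤ k t) {B' : ℝ}
    (hkB : ∀ t, k t ≤ B')
    (hK : ∀ t x, ‖∫ ξ, wave (L (t, x)) ξ * (w ξ : ℂ)‖ ≤ k t)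
    {A : ℝ} (hA : 0 < A) (hkA : ∫ t, k t ≤ A) :
    mixedNorm 2 ⊤ (fun p => freeWave f (L p)) ≤ ENNReal.ofReal (Real.sqrt (A / c)) * ‖f‖ₑ := by
  have hπ : 1 ≤ (2 * Real.pi) ^ 3 := one_le_pow₀ (by linarith [Real.pi_gt_three])
  set a : ℝ := ((2 * Real.pi) ^ 3)⁻¹ with ha
  have ha0 : 0 < a := by positivity
  have hn : ∀ ξ, ‖a • hat f ξ‖ ^ 2 = a ^ 2 * ‖hat f ξ‖ ^ 2 := fun ξ => by
    rw [norm_smul, Real.norm_of_nonneg ha0.le, mul_pow]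
  have h := mixedNorm_synth_le hw hw0 hc (g := fun ξ => a • hat f ξ)
    ((integrable_hat hS hf).smul a)
    (by simpa only [hn] using (integrable_norm_hat_sq f).const_mul (a ^ 2))
    (by
      filter_upwards [hf] with ξ hξ hne
      refine hcw ξ (by_contra fun hS => hne ?_)
      rw [hξ hS, smul_zero]) hL hLsub hk hkm hk0 hkB hK hA hkA
  rw [freeWave_eq_synth]
  refine h.trans ?_
  simp only [hn]
  rw [integral_const_mul, integral_norm_hat_sq, ← ofReal_norm,
    ← ENNReal.ofReal_mul (Real.sqrt_nonneg _)]
  refine ENNReal.ofReal_le_ofReal ?_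
  have e : a ^ 2 * ((2 * Real.pi) ^ 3 * ‖f‖ ^ 2) = a * ‖f‖ ^ 2 := by
    rw [ha]; field_simp
  rw [e, ← Real.sqrt_sq (norm_nonneg f), ← Real.sqrt_mul (by positivity), Real.sqrt_sq (norm_nonneg f)]
  refine Real.sqrt_le_sqrt ?_
  gcongr
  have : a ≤ 1 := inv_le_one_of_one_le₀ hπ
  nlinarith [sq_nonneg ‖f‖]

/-! ### The time majorant -/

/-- The integrable profile `(1 + |t|)^{-3/2}`. -/
noncomputable def profile (t : ℝ) : ℝ := (1 + |t|) ^ (-(3 / 2) : ℝ)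

lemma profile_nonneg (t : ℝ) : 0 ≤ profile t := by unfold profile; positivity

lemma profile_le_one (t : ℝ) : profile t ≤ 1 :=
  Real.rpow_le_one_of_one_le_of_nonpos (by linarith [abs_nonneg t]) (by norm_num)

lemma measurable_profile : Measurable profile := by unfold profile; fun_prop

lemma integrable_profile : Integrable profile :=
  integrable_one_add_norm (by simp; norm_num)

/-- The `TT*` principle when the kernel is dominated by a rescaled profile. -/
lemma mixedNorm_freeWave_le_of_profile {w : E3 → ℝ} (hw : Integrable w) (hw0 : ∀ ξ, 0 ≤ w ξ)
    {S : Set E3} (hS : Bornology.IsBounded S) {c : ℝ} (hc : 0 < c) (hcw : ∀ ξ ∈ S, c ≤ w ξ)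
    {f : L2} (hf : FourierSupportedIn f S)
    {L : ℝ × E3 → ℝ × E3} (hL : Continuous L) (hLsub : ∀ p q, L (p - q) = L p - L q)
    {B a : ℝ} (hB : 0 < B) (ha : 0 < a)
    (hK : ∀ t x, ‖∫ ξ, wave (L (t, x)) ξ * (w ξ : ℂ)‖ ≤ B * profile (a * t)) :
    mixedNorm 2 ⊤ (fun p => freeWave f (L p))
      ≤ ENNReal.ofReal (Real.sqrt (B * (1 + ∫ t, profile t) / a / c)) * ‖f‖ₑ := by
  have hI : 0 ≤ ∫ t, profile t := integral_nonneg profile_nonneg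
  refine mixedNorm_freeWave_le hw hw0 hS hc hcw hf hL hLsub
    (k := fun t => B * profile (a * t)) (B' := B)
    ((integrable_profile.comp_mul_left' ha.ne').const_mul B)
    ((measurable_profile.comp (measurable_const_mul a)).const_mul B)
    (fun t => mul_nonneg hB.le (profile_nonneg _))
    (fun t => mul_le_of_le_one_right hB.le (profile_le_one _)) hK (by positivity) ?_
  rw [integral_const_mul, Measure.integral_comp_mul_left, abs_of_pos (inv_pos.2 ha), smul_eq_mul,
    div_eq_mul_inv, mul_assoc]
  gcongr ?_ * ?_
  rw [mul_comm]
  gcongr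
  linarith

/-! ### Frequency supports -/

lemma chiTilde_eq (ρ : ℝ → ℝ) (k : ℤ) (ξ : E3) :
    chiTilde ρ k ξ = ρ ((2 : ℝ) ^ (-(k + 1)) * ‖ξ‖) - ρ ((2 : ℝ) ^ (-k + 2) * ‖ξ‖) := by
  simp only [chiTilde, chi]
  rw [show -(k - 1) = -k + 1 by ring, show -k + 1 + 1 = -k + 2 by ring,
    show -(k + 1) + 1 = -k by ring]
  ring

lemma chiTilde_support {ρ : ℝ → ℝ} (hρ : IsCutoff ρ) {k : ℤ} {ξ : E3} (h : chiTilde ρ k ξ ≠ 0) :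
    (2 : ℝ) ^ (k - 2) ≤ ‖ξ‖ ∧ ‖ξ‖ ≤ (2 : ℝ) ^ (k + 2) := by
  have hzero : ∀ s, 2 ≤ s → ρ s = 0 := fun s hs =>
    image_eq_zero_of_notMem_tsupport fun hmem => by linarith [(hρ.tsupport_subset hmem).2]
  have h2 : (0 : ℝ) < 2 := two_pos
  rw [chiTilde_eq] at h
  have hmono : (2 : ℝ) ^ (-(k + 1)) * ‖ξ‖ ≤ (2 : ℝ) ^ (-k + 2) * ‖ξ‖ := by
    gcongr
    · norm_num
    · linarith
  constructor
  · by_contra! hlt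
    have h1 : (2 : ℝ) ^ (-k + 2) * ‖ξ‖ ≤ 1 := by
      calc (2 : ℝ) ^ (-k + 2) * ‖ξ‖ ≤ (2 : ℝ) ^ (-k + 2) * (2 : ℝ) ^ (k - 2) := by gcongr
        _ = 1 := by rw [← zpow_add₀ h2.ne']; simp
    have h0 : 0 ≤ (2 : ℝ) ^ (-(k + 1)) * ‖ξ‖ := by positivity
    refine h ?_
    rw [hρ.eq_one _ (abs_le.2 ⟨by linarith, by linarith⟩),
      hρ.eq_one _ (abs_le.2 ⟨by linarith, by linarith⟩), sub_self]
  · by_contra! hlt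
    have h1 : 2 ≤ (2 : ℝ) ^ (-(k + 1)) * ‖ξ‖ := by
      calc (2 : ℝ) = (2 : ℝ) ^ (-(k + 1)) * (2 : ℝ) ^ (k + 2) := by
            rw [← zpow_add₀ h2.ne', show -(k + 1) + (k + 2) = 1 by ring, zpow_one]
        _ ≤ _ := by gcongr
    refine h ?_
    rw [hzero _ h1, hzero _ (h1.trans hmono), sub_self]

/-- The closed dyadic shell `2^{k-2} ≤ |ξ| ≤ 2^{k+2}`. -/
def shell (k : ℤ) : Set E3 := {ξ | (2 : ℝ) ^ (k - 2) ≤ ‖ξ‖ ∧ ‖ξ‖ ≤ (2 : ℝ) ^ (k + 2)}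

/-- The closed cone of directions at chordal distance at most `r` from the unit vector `ω`, written
without division by `|ξ|`. -/
def cone (r : ℝ) (ω : E3) : Set E3 := {ξ | ‖ξ‖ - inner ℝ ω ξ ≤ ‖ξ‖ * (r ^ 2 / 2)}

lemma isClosed_shell (k : ℤ) : IsClosed (shell k) :=
  (isClosed_le continuous_const continuous_norm).inter (isClosed_le continuous_norm continuous_const)

lemma isClosed_cone (r : ℝ) (ω : E3) : IsClosed (cone r ω) :=
  isClosed_le (by fun_prop) (by fun_prop)

lemma isBounded_shell (k : ℤ) : Bornology.IsBounded (shell k) :=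
  (Metric.isBounded_closedBall (x := (0 : E3)) (r := (2 : ℝ) ^ (k + 2))).subset fun _ hξ =>
    mem_closedBall_zero_iff.2 hξ.2

lemma annulus_subset_shell {ρ : ℝ → ℝ} (hρ : IsCutoff ρ) (k : ℤ) : annulus ρ k ⊆ shell k :=
  closure_minimal (fun _ hξ => chiTilde_support hρ hξ) (isClosed_shell k)

lemma mem_cone_of_angle_le {r : ℝ} {ω ξ : E3} (hω : ‖ω‖ = 1)
    (h : InnerProductGeometry.angle ω ξ ≤ r) : ξ ∈ cone r ω := by
  have h1 := InnerProductGeometry.cos_angle_mul_norm_mul_norm ω ξ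
  have h2 := Real.one_sub_sq_div_two_le_cos (x := InnerProductGeometry.angle ω ξ)
  have h0 := InnerProductGeometry.angle_nonneg ω ξ
  rw [hω, one_mul] at h1
  rw [cone, Set.mem_ofPred_eq, ← h1]
  have h3 : InnerProductGeometry.angle ω ξ ^ 2 ≤ r ^ 2 := by gcongr
  nlinarith [norm_nonneg ξ]

lemma etaTilde_support (𝒦 : AngularDecomposition) {l : ℕ} {ω ξ : E3} (hω : ω ∈ 𝒦.centers l)
    (hξ : ξ ≠ 0) (h : 𝒦.etaTilde l ω ξ ≠ 0) : ξ ∈ cone (𝒦.M * ((2 : ℝ) ^ l)⁻¹ / 2) ω := by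
  rw [mul_div_assoc]
  exact mem_cone_of_angle_le (𝒦.norm_center l ω hω) ((𝒦.etaTilde_cutoff l ω hω).support ξ hξ h)

lemma ne_zero_of_mem_shell {k : ℤ} {ξ : E3} (h : ξ ∈ shell k) : ξ ≠ 0 := fun h0 => by
  have h1 := h.1
  rw [h0, norm_zero] at h1
  have : (0 : ℝ) < 2 ^ (k - 2) := by positivity
  linarith

lemma sector_subset (𝒦 : AngularDecomposition) {ρ : ℝ → ℝ} (hρ : IsCutoff ρ) (k : ℤ) {l : ℕ} {ω : E3}
    (hω : ω ∈ 𝒦.centers l) :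
    𝒦.sector ρ k l ω ⊆ shell k ∩ cone (𝒦.M * ((2 : ℝ) ^ l)⁻¹ / 2) ω := by
  refine closure_minimal (fun ξ hξ => ?_) ((isClosed_shell k).inter (isClosed_cone _ _))
  have h1 := chiTilde_support hρ (right_ne_zero_of_mul hξ)
  exact ⟨h1, etaTilde_support 𝒦 hω (ne_zero_of_mem_shell h1) (left_ne_zero_of_mul hξ)⟩

/-! ### Low frequencies -/

lemma low_frequency (k₀ : ℤ) : ∃ C : ℝ≥0, ∀ k : ℤ, k ≤ k₀ → ∀ f : L2,
    FourierSupportedIn f (shell k) →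
      mixedNorm 2 ⊤ (freeWave f) ≤ C * (2 : ℝ≥0∞) ^ ((k : ℝ) / 2) * ‖f‖ₑ := by
  obtain ⟨C, hC, hker⟩ := exists_norm_kernel_le
    (b := (2 : ℝ) ^ (-2 * (k₀ : ℝ))) (by positivity)
  set c := Real.exp (-8) / (1 + (2 : ℝ) ^ (k₀ + 2)) with hc
  have hc0 : 0 < c := by positivity
  set I₀ := 1 + ∫ t, profile t with hI₀
  have hI₀0 : 0 < I₀ := by
    have : 0 ≤ ∫ t, profile t := integral_nonneg profile_nonneg
    positivity
  refine ⟨Real.toNNReal (Real.sqrt (C * I₀ / c)), fun k hk f hf => ?_⟩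
  -- the weight lives at the scale `β^{-1/2} = 2^k`
  set β := (2 : ℝ) ^ (-2 * (k : ℝ)) with hβ
  have hβ0 : 0 < β := by positivity
  have hbβ : (2 : ℝ) ^ (-2 * (k₀ : ℝ)) ≤ β := by
    refine Real.rpow_le_rpow_of_exponent_le (by norm_num) ?_
    have : (k : ℝ) ≤ k₀ := by exact_mod_cast hk
    linarith
  have hβk : β * ((2 : ℝ) ^ k) ^ 2 = 1 := by
    rw [hβ, ← Real.rpow_intCast, ← Real.rpow_natCast, ← Real.rpow_mul two_pos.le,
      ← Real.rpow_add two_pos]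
    norm_num
    ring_nf
    simp
  have hw : ∀ ξ ∈ shell k, c ≤ ballWeight β ξ := fun ξ hξ => by
    have hξ2 : ‖ξ‖ ≤ 4 * (2 : ℝ) ^ k := by
      have := hξ.2
      rw [zpow_add₀ two_ne_zero] at this
      norm_num at this
      linarith
    have hE := one_le_bracket ξ
    have hEsq := bracket_sq ξ
    have h1 : β * (bracket ξ - 1) ≤ 8 := by
      have h2 : bracket ξ - 1 ≤ ‖ξ‖ ^ 2 / 2 := by nlinarith [sq_nonneg (bracket ξ - 1)]
      have h3 : ‖ξ‖ ^ 2 ≤ (4 * (2 : ℝ) ^ k) ^ 2 := by gcongr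
      calc β * (bracket ξ - 1) ≤ β * ((4 * (2 : ℝ) ^ k) ^ 2 / 2) := by gcongr; linarith
        _ = 8 * (β * ((2 : ℝ) ^ k) ^ 2) := by ring
        _ = 8 := by rw [hβk, mul_one]
    have h4 : bracket ξ ≤ 1 + (2 : ℝ) ^ (k₀ + 2) := by
      have h5 : bracket ξ ≤ 1 + ‖ξ‖ := by
        have := norm_nonneg ξ
        nlinarith
      have h6 : (2 : ℝ) ^ (k + 2) ≤ (2 : ℝ) ^ (k₀ + 2) :=
        zpow_le_zpow_right₀ (by norm_num) (by linarith)
      linarith [hξ.2]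
    rw [hc, ballWeight]
    gcongr
  have h := mixedNorm_freeWave_le_of_profile (L := id) (integrable_ballWeight hβ0)
    (fun ξ => (ballWeight_pos β ξ).le) (isBounded_shell k) hc0 hw hf continuous_id
    (fun p q => rfl) (B := C * β ^ (-(3 / 2) : ℝ)) (a := β⁻¹) (by positivity) (by positivity)
    (fun t x => by
      have h1 := hker (β - Complex.I * (t : ℂ)) (by simpa using hbβ) x
      rw [id, norm_integral_wave_ballWeight]
      refine h1.trans (le_of_eq ?_)
      rw [profile, abs_mul, abs_of_pos (inv_pos.2 hβ0), mul_assoc,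
        ← Real.mul_rpow hβ0.le (by positivity)]
      congr 2
      simp only [Complex.sub_re, Complex.sub_im, Complex.ofReal_re, Complex.ofReal_im,
        Complex.mul_re, Complex.mul_im, Complex.I_re, Complex.I_im]
      rw [mul_add, ← mul_assoc, mul_inv_cancel₀ hβ0.ne']
      simp)
  refine h.trans (le_of_eq ?_)
  have e1 : C * β ^ (-(3 / 2) : ℝ) * I₀ / β⁻¹ / c = (C * I₀ / c) * (2 : ℝ) ^ (k : ℝ) := by
    have e2 : β ^ (-(3 / 2) : ℝ) * β = (2 : ℝ) ^ (k : ℝ) := by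
      nth_rewrite 2 [← Real.rpow_one β]
      rw [← Real.rpow_add hβ0, hβ, ← Real.rpow_mul two_pos.le]
      congr 1
      ring
    rw [← e2, div_inv_eq_mul]
    ring
  have e3 : (2 : ℝ≥0∞) ^ ((k : ℝ) / 2) = ENNReal.ofReal (Real.sqrt ((2 : ℝ) ^ (k : ℝ))) := by
    rw [Real.sqrt_eq_rpow, ← Real.rpow_mul two_pos.le,
      ← ENNReal.ofReal_rpow_of_pos two_pos, ENNReal.ofReal_ofNat]
    congr 1
    ring
  rw [e3, e1, Real.sqrt_mul (by positivity), ENNReal.ofReal_mul (Real.sqrt_nonneg _)]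
  rfl

/-! ### One sector at high frequency -/

lemma shell_natCast_bounds {k : ℕ} {ξ : E3} (h : ξ ∈ shell k) :
    (2 : ℝ) ^ k / 4 ≤ ‖ξ‖ ∧ ‖ξ‖ ≤ 4 * (2 : ℝ) ^ k := by
  have h1 := h.1
  have h2 := h.2
  rw [zpow_sub₀ two_ne_zero, zpow_natCast] at h1
  rw [zpow_add₀ two_ne_zero, zpow_natCast] at h2
  norm_num at h1 h2
  exact ⟨h1, by linarith⟩

/-- On the sector of width `1` around `2^k ω` the boosted energy is bounded, so the boosted weight
is comparable to `2^{-k}`. -/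
lemma sectorWeight_ge {M : ℝ} {k : ℕ} {ω ξ : E3}
    (hsh : ξ ∈ shell k) (hco : ξ ∈ cone (M * ((2 : ℝ) ^ k)⁻¹ / 2) ω) :
    Real.exp (-(71 + M ^ 2 / 2)) / (5 * (2 : ℝ) ^ k) ≤ sectorWeight (2 ^ k) ω ξ := by
  obtain ⟨h1, h2⟩ := shell_natCast_bounds hsh
  set s : ℝ := 2 ^ k with hs
  have hs1 : 1 ≤ s := one_le_pow₀ (by norm_num)
  have hE1 := one_le_bracket ξ
  have hE2 := bracket_sq ξ
  have hE3 := norm_le_bracket ξ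
  have hγ := bra_sq s
  have hγs := lt_bra s
  set E := bracket ξ
  set γ := bra s
  -- the radial part: `γE - s|ξ|` is small by conjugation, as `(γE)² - (s|ξ|)² = s² + 1 + |ξ|²`
  have hrad : γ * E - s * ‖ξ‖ ≤ 72 := by
    have hpos : s ^ 2 / 4 ≤ γ * E + s * ‖ξ‖ := by
      have : s * (s / 4) ≤ γ * E := by
        have h3 := h1.trans hE3
        have h4 : 0 ≤ γ := by linarith
        gcongr
      have h0 : 0 ≤ s * ‖ξ‖ := by positivity
      nlinarith
    have hprod : (γ * E - s * ‖ξ‖) * (γ * E + s * ‖ξ‖) ≤ 18 * s ^ 2 := by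
      have e : (γ * E - s * ‖ξ‖) * (γ * E + s * ‖ξ‖) = s ^ 2 + 1 + ‖ξ‖ ^ 2 := by
        calc _ = γ ^ 2 * E ^ 2 - s ^ 2 * ‖ξ‖ ^ 2 := by ring
          _ = _ := by rw [hγ, hE2]; ring
      have h3 : ‖ξ‖ ^ 2 ≤ (4 * s) ^ 2 := by gcongr
      rw [e]
      nlinarith
    by_contra! hlt
    nlinarith [sq_nonneg s]
  -- the angular part: `|ξ| - ω·ξ` is quadratic in the angle, which is `O(2^{-k})`
  have hang : s * (‖ξ‖ - inner ℝ ω ξ) ≤ M ^ 2 / 2 := by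
    have h3 : ‖ξ‖ - inner ℝ ω ξ ≤ ‖ξ‖ * ((M * s⁻¹ / 2) ^ 2 / 2) := hco
    calc s * (‖ξ‖ - inner ℝ ω ξ) ≤ s * ((4 * s) * ((M * s⁻¹ / 2) ^ 2 / 2)) := by
          refine mul_le_mul_of_nonneg_left (h3.trans ?_) (by positivity)
          gcongr
      _ = M ^ 2 / 2 := by field_simp; ring
  have hE5 : E ≤ 5 * s := by nlinarith [norm_nonneg ξ]
  rw [sectorWeight]
  gcongr
  linarith

lemma norm_boosted_ge {s : ℝ} {ω : E3} (hω : ‖ω‖ = 1) (t : ℝ) (x : E3) :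
    |s * t + bra s * inner ℝ ω x| ≤ ‖x + (s * t + (bra s - 1) * inner ℝ ω x) • ω‖ := by
  have h := abs_real_inner_le_norm ω (x + (s * t + (bra s - 1) * inner ℝ ω x) • ω)
  rw [hω, one_mul, inner_add_right, inner_smul_right, real_inner_self_eq_norm_sq, hω] at h
  refine le_trans (le_of_eq ?_) h
  congr 1
  ring

lemma framePoint_sub (lam : ℝ) (b : OrthonormalBasis (Fin 3) ℝ E3) (p q : ℝ × E3) :
    framePoint lam b (p - q) = framePoint lam b p - framePoint lam b q := by
  simp only [framePoint, Prod.fst_sub, Prod.snd_sub, PiLp.sub_apply]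
  module

lemma continuous_framePoint (lam : ℝ) (b : OrthonormalBasis (Fin 3) ℝ E3) :
    Continuous (framePoint lam b) := by
  unfold framePoint
  fun_prop

/-- The boosted first coordinate depends on the frame time only: `Θ_{λ(k),ω}` is, up to a factor, the
covector of the boost. -/
lemma boosted_framePoint (k : ℕ) (b : OrthonormalBasis (Fin 3) ℝ E3) (t : ℝ) (x : E3) :
    (2 : ℝ) ^ k * (framePoint (lamK k) b (t, x)).1
        + bra (2 ^ k) * inner ℝ (b 0) (framePoint (lamK k) b (t, x)).2
      = bra (2 ^ k) * Real.sqrt (1 + lamK k ^ 2) * t := by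
  set s : ℝ := 2 ^ k with hs
  have hs0 : 0 < s := by positivity
  have hγ := bra_pos s
  have hlam : lamK k = s / bra s := by
    have h1 : (1 : ℝ) + (2 ^ (2 * k))⁻¹ = (1 + s ^ 2) / s ^ 2 := by
      rw [hs, ← pow_mul, mul_comm k 2]
      field_simp
      ring
    rw [lamK, h1, Real.sqrt_div (by positivity), Real.sqrt_sq hs0.le, inv_div, bra]
  have h01 : inner ℝ (b 0) (b 1) = 0 := b.inner_eq_zero (by decide)
  have h02 : inner ℝ (b 0) (b 2) = 0 := b.inner_eq_zero (by decide)
  have h00 : inner ℝ (b 0) (b 0) = 1 := b.inner_eq_one 0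
  set r := Real.sqrt (1 + lamK k ^ 2) with hr
  have hr0 : 0 < r := Real.sqrt_pos.2 (by positivity)
  have hr2 : r ^ 2 = 1 + lamK k ^ 2 := Real.sq_sqrt (by positivity)
  simp only [framePoint, theta, thetaPerp, Prod.fst_add, Prod.snd_add, Prod.smul_fst, Prod.smul_snd,
    inner_add_right, inner_smul_right, h00, h01, h02, smul_eq_mul, ← hr]
  rw [hlam] at hr2 ⊢
  have hγ2 := bra_sq s
  field_simp at hr2 ⊢
  linear_combination (-t) * hr2

/-- Both estimates for a sector, with a bound uniform in the sector. -/
lemma sector_estimates (M : ℝ) : ∃ C : ℝ≥0, ∀ (k : ℕ) (b : OrthonormalBasis (Fin 3) ℝ E3) (f : L2),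
    FourierSupportedIn f (shell k ∩ cone (M * ((2 : ℝ) ^ k)⁻¹ / 2) (b 0)) →
      mixedNorm 2 ⊤ (freeWave f) ≤ C * (2 : ℝ≥0∞) ^ k * ‖f‖ₑ ∧
      frameNorm 2 ⊤ (lamK k) b (freeWave f) ≤ C * ‖f‖ₑ := by
  obtain ⟨C, hC, hker⟩ := exists_norm_kernel_one_le
  set I₀ := 1 + ∫ t, profile t with hI₀
  have hI₀0 : 0 < I₀ := by
    have : 0 ≤ ∫ t, profile t := integral_nonneg profile_nonneg
    positivity
  set c := Real.exp (-(71 + M ^ 2 / 2)) / 5 with hc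
  have hc0 : 0 < c := by positivity
  set D := 2 * (C * I₀ / c) with hD
  refine ⟨Real.toNNReal (Real.sqrt D), fun k b f hf => ?_⟩
  have hω : ‖b 0‖ = 1 := b.norm_eq_one 0
  set s : ℝ := 2 ^ k with hs
  have hs1 : 1 ≤ s := one_le_pow₀ (by norm_num)
  have hγ := lt_bra s
  have hγ2 : bra s ≤ 2 * s := (bra_le s).trans (by rw [abs_of_nonneg (by linarith)]; linarith)
  have hS : Bornology.IsBounded (shell k ∩ cone (M * s⁻¹ / 2) (b 0)) :=
    (isBounded_shell k).subset Set.inter_subset_left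
  have hcw : ∀ ξ ∈ shell k ∩ cone (M * s⁻¹ / 2) (b 0), c / s ≤ sectorWeight s (b 0) ξ :=
    fun ξ hξ => by
      refine le_trans (le_of_eq ?_) (sectorWeight_ge hξ.1 hξ.2)
      rw [hc, div_div]
  have hw := integrable_sectorWeight (by linarith : 0 ≤ s) hω
  have hprof : ∀ y, 0 ≤ y → C * (1 + y) ^ (-(3 / 2) : ℝ) = C * profile y := fun y hy => by
    rw [profile, abs_of_nonneg hy]
  have hpabs : ∀ a t : ℝ, 0 < a → profile (a * |t|) = profile (a * t) := fun a t ha => by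
    rw [profile, profile, abs_mul, abs_abs, abs_mul]
  constructor
  · have h := mixedNorm_freeWave_le_of_profile (L := id) hw
      (fun ξ => (sectorWeight_pos s (b 0) ξ).le) hS (by positivity) hcw hf continuous_id
      (fun p q => rfl) (B := C) (a := (bra s)⁻¹) hC (inv_pos.2 (bra_pos s))
      (fun t x => by
        have hγ0 := bra_pos s
        rw [id, norm_integral_wave_sectorWeight (by linarith) hω, ← hpabs _ _ (inv_pos.2 hγ0),
          ← hprof _ (by positivity)]
        refine hker _ _ _ (by positivity) ?_
        have h1 := norm_boosted_ge (s := s) hω t x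
        set t' := bra s * t + s * inner ℝ (b 0) x with ht'
        set x₁ := s * t + bra s * inner ℝ (b 0) x with hx₁
        -- inverting the boost, `|t|` is at most `⟨s⟩ (|t'| + |x'|)`
        have e : t = bra s * t' - s * x₁ := by
          rw [ht', hx₁]
          linear_combination (-t) * bra_sq s
        have h2 : |t| ≤ bra s * |t'| + s * |x₁| := by
          rw [e]
          refine (abs_sub _ _).trans_eq ?_
          rw [abs_mul, abs_mul, abs_of_pos hγ0, abs_of_pos (by linarith : 0 < s)]
        rw [inv_mul_le_iff₀ hγ0]
        nlinarith [abs_nonneg x₁])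
    refine h.trans ?_
    have e3 : (2 : ℝ≥0∞) ^ k = ENNReal.ofReal s := by
      rw [hs, ENNReal.ofReal_pow two_pos.le, ENNReal.ofReal_ofNat]
    have e4 : (Real.toNNReal (Real.sqrt D) : ℝ≥0∞) = ENNReal.ofReal (Real.sqrt D) := rfl
    rw [e3, e4, ← ENNReal.ofReal_mul (Real.sqrt_nonneg _)]
    gcongr
    rw [← Real.sqrt_sq (by linarith : 0 ≤ s), ← Real.sqrt_mul (by positivity),
      Real.sqrt_sq (by linarith : 0 ≤ s)]
    refine Real.sqrt_le_sqrt ?_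
    calc C * I₀ / (bra s)⁻¹ / (c / s) = C * I₀ / c * (bra s * s) := by
          rw [div_inv_eq_mul]; field_simp
      _ ≤ C * I₀ / c * (2 * s * s) := by gcongr
      _ = D * s ^ 2 := by rw [hD]; ring
  · have h := mixedNorm_freeWave_le_of_profile hw
      (fun ξ => (sectorWeight_pos s (b 0) ξ).le) hS (by positivity) hcw hf
      (continuous_framePoint (lamK k) b) (framePoint_sub (lamK k) b) (B := C) (a := bra s) hC
      (bra_pos s)
      (fun t x => by
        have hγ0 := bra_pos s
        set p := framePoint (lamK k) b (t, x) with hp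
        rw [show p = (p.1, p.2) from rfl, norm_integral_wave_sectorWeight (by linarith) hω,
          ← hpabs _ _ hγ0, ← hprof _ (by positivity)]
        refine hker _ _ _ (by positivity) ?_
        have h1 := norm_boosted_ge (s := s) hω p.1 p.2
        rw [hp, boosted_framePoint, ← hp, abs_mul, abs_mul, abs_of_pos hγ0,
          abs_of_nonneg (Real.sqrt_nonneg _)] at h1
        have h2 : 1 ≤ Real.sqrt (1 + lamK k ^ 2) := by
          rw [Real.one_le_sqrt]; nlinarith [sq_nonneg (lamK k)]
        have h3 : bra s * |t| ≤ bra s * Real.sqrt (1 + lamK k ^ 2) * |t| := by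
          gcongr
          nlinarith
        have h4 := abs_nonneg (bra s * p.1 + s * inner ℝ (b 0) p.2)
        linarith)
    refine h.trans ?_
    have e4 : (Real.toNNReal (Real.sqrt D) : ℝ≥0∞) = ENNReal.ofReal (Real.sqrt D) := rfl
    rw [e4]
    gcongr
    calc C * I₀ / bra s / (c / s) = C * I₀ / c * (s / bra s) := by
          have := bra_pos s
          field_simp
      _ ≤ C * I₀ / c * 2 := by
          gcongr
          exact ((div_le_one (bra_pos s)).2 hγ.le).trans (by norm_num)
      _ = D := by rw [hD]; ring

/-! ### Counting caps -/

lemma angle_le_of_norm_sub_le {ω y : E3} (hω : ‖ω‖ = 1) (hy : ‖y‖ = 1) {a : ℝ}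
    (h : ‖ω - y‖ ≤ a / 2) : InnerProductGeometry.angle ω y ≤ a := by
  set θ := InnerProductGeometry.angle ω y with hθ
  have hθ0 : 0 ≤ θ := InnerProductGeometry.angle_nonneg _ _
  have hθπ : θ ≤ Real.pi := InnerProductGeometry.angle_le_pi _ _
  have h1 := InnerProductGeometry.cos_angle_mul_norm_mul_norm ω y
  rw [hω, hy, mul_one, mul_one, ← hθ] at h1
  have h2 := norm_sub_sq_real ω y
  rw [hω, hy, ← h1] at h2
  have h3 := Real.cos_le_one_sub_mul_cos_sq (x := θ) (by rwa [abs_of_nonneg hθ0])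
  have h4 : ‖ω - y‖ ^ 2 ≤ (a / 2) ^ 2 := by gcongr
  have h5 : 2 / Real.pi ^ 2 * θ ^ 2 ≤ a ^ 2 / 8 := by nlinarith
  rw [div_mul_eq_mul_div, div_le_iff₀ (by positivity)] at h5
  have h6 : Real.pi ^ 2 ≤ 4 ^ 2 := by
    have := Real.pi_lt_four
    gcongr
  have ha : 0 ≤ a := by have := norm_nonneg (ω - y); linarith
  refine abs_le_of_sq_le_sq' ?_ ha |>.2
  nlinarith [sq_nonneg a]

/-- On the part of the sphere where the `i`-th coordinate is large and of a given sign, the two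
other coordinates are bi-Lipschitz. -/
lemma norm_sub_le_of_coord_close {ω y : E3} (hω : ‖ω‖ = 1) (hy : ‖y‖ = 1) (i : Fin 3) {h : ℝ}
    (hiω : 1 / 3 ≤ ω i ^ 2) (hiy : 1 / 3 ≤ y i ^ 2) (hs : 0 ≤ ω i ↔ 0 ≤ y i)
    (h1 : |ω (i + 1) - y (i + 1)| ≤ h) (h2 : |ω (i + 2) - y (i + 2)| ≤ h) :
    ‖ω - y‖ ≤ 5 * h := by
  have hsum : ∀ v : E3, ‖v‖ ^ 2 = v i ^ 2 + v (i + 1) ^ 2 + v (i + 2) ^ 2 := fun v => by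
    rw [EuclideanSpace.real_norm_sq_eq, Fin.sum_univ_three]
    fin_cases i <;> simp <;> ring
  have h0 : 0 ≤ h := (abs_nonneg _).trans h1
  have e1 := hsum ω
  have e2 := hsum y
  rw [hω] at e1
  rw [hy] at e2
  have hb : ∀ v : E3, ‖v‖ = 1 → ∀ j, |v j| ≤ 1 := fun v hv j => by
    have := PiLp.norm_apply_le v j
    rwa [hv] at this
  have hprod : 1 ≤ |ω i + y i| := by
    have hnn : 0 ≤ ω i * y i := by
      by_cases hc : 0 ≤ ω i
      · exact mul_nonneg hc (hs.1 hc)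
      · have hc' : ¬ 0 ≤ y i := fun h => hc (hs.2 h)
        exact mul_nonneg_of_nonpos_of_nonpos (not_le.1 hc).le (not_le.1 hc').le
    have hge : 1 / 3 ≤ ω i * y i := by
      refine le_of_sq_le_sq ?_ hnn
      rw [mul_pow]
      nlinarith
    refine (one_le_sq_iff_one_le_abs _).1 ?_
    nlinarith
  have hdiff : |ω i - y i| ≤ 4 * h := by
    have e3 : (ω i - y i) * (ω i + y i) = -((ω (i + 1) - y (i + 1)) * (ω (i + 1) + y (i + 1))
        + (ω (i + 2) - y (i + 2)) * (ω (i + 2) + y (i + 2))) := by linarith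
    have e4 : ∀ j, |ω j + y j| ≤ 2 := fun j => by
      refine (abs_add_le _ _).trans ?_
      linarith [hb ω hω j, hb y hy j]
    calc |ω i - y i| ≤ |ω i - y i| * |ω i + y i| := le_mul_of_one_le_right (abs_nonneg _) hprod
      _ = |(ω (i + 1) - y (i + 1)) * (ω (i + 1) + y (i + 1))
          + (ω (i + 2) - y (i + 2)) * (ω (i + 2) + y (i + 2))| := by rw [← abs_mul, e3, abs_neg]
      _ ≤ h * 2 + h * 2 := by
          refine (abs_add_le _ _).trans ?_
          rw [abs_mul, abs_mul]
          gcongr <;> exact e4 _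
      _ = 4 * h := by ring
  refine abs_le_of_sq_le_sq' ?_ (by positivity) |>.2
  rw [hsum]
  simp only [PiLp.sub_apply]
  have s0 := sq_le_sq' (abs_le.1 hdiff).1 (abs_le.1 hdiff).2
  have s1 := sq_le_sq' (abs_le.1 h1).1 (abs_le.1 h1).2
  have s2 := sq_le_sq' (abs_le.1 h2).1 (abs_le.1 h2).2
  nlinarith

lemma exists_coord_sq_ge {ω : E3} (hω : ‖ω‖ = 1) : ∃ i, 1 / 3 ≤ ω i ^ 2 := by
  by_contra! hlt
  have h := EuclideanSpace.real_norm_sq_eq ω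
  rw [Fin.sum_univ_three, hω] at h
  linarith [hlt 0, hlt 1, hlt 2]

/-- A disc of radius `R` on the sphere contains at most `O((R 2^l + 1)²)` centers of caps of diameter
`2^{-l}`: a grid in two of the coordinates cuts it into that many cells, and all centers in one cell
belong to caps with a common point. -/
lemma exists_card_centers_le (𝒦 : AngularDecomposition) : ∃ K : ℝ, 0 < K ∧
    ∀ (l : ℕ) (ω₀ : E3) (R : ℝ), 0 ≤ R → ∀ s ⊆ 𝒦.centers l, (∀ ω ∈ s, ‖ω - ω₀‖ ≤ R) →
      (s.card : ℝ) ≤ K * (R * 2 ^ l + 1) ^ 2 := by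
  classical
  obtain ⟨N, hN⟩ := 𝒦.finite_overlap
  refine ⟨9600 * N + 1, by positivity, fun l ω₀ R hR s hs hsR => ?_⟩
  -- centers in one grid cell of side `h` are at distance at most `5h = 2^{-l}/4`, hence at an angle
  -- of at most `2^{-l}/2`, the radius of a cap
  set h : ℝ := ((2 : ℝ) ^ l)⁻¹ / 20 with hh
  have h0 : 0 < h := by positivity
  have hRh : R / h = 20 * (R * 2 ^ l) := by rw [hh]; field_simp
  set m : ℕ := ⌈R / h⌉₊ with hm
  have hmR : R / h ≤ m := Nat.le_ceil _
  have hmR' : (m : ℝ) ≤ 20 * (R * 2 ^ l) + 1 := by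
    rw [← hRh]; exact (Nat.ceil_lt_add_one (by positivity)).le
  choose! i hi using fun (ω : E3) (hω : ‖ω‖ = 1) => exists_coord_sq_ge hω
  -- the cell of a center: the index and the sign of a large coordinate, and the grid cell of the
  -- other two coordinates
  set F : E3 → Fin 3 × Bool × ℤ × ℤ := fun ω => (i ω, decide (0 ≤ ω (i ω)),
    ⌊(ω (i ω + 1) - ω₀ (i ω + 1)) / h⌋, ⌊(ω (i ω + 2) - ω₀ (i ω + 2)) / h⌋) with hF
  set t : Finset (Fin 3 × Bool × ℤ × ℤ) := Finset.univ ×ˢ Finset.univ ×ˢ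
    Finset.Icc (-(m : ℤ)) m ×ˢ Finset.Icc (-(m : ℤ)) m with ht
  have hmaps : ∀ ω ∈ s, F ω ∈ t := fun ω hω => by
    have hfl : ∀ j, ⌊(ω j - ω₀ j) / h⌋ ∈ Finset.Icc (-(m : ℤ)) m := fun j => by
      have h1 : |(ω j - ω₀ j) / h| ≤ m := by
        rw [abs_div, abs_of_pos h0]
        refine le_trans ?_ hmR
        gcongr
        exact (PiLp.norm_apply_le (ω - ω₀) j).trans (hsR ω hω)
      obtain ⟨h2, h3⟩ := abs_le.1 h1
      rw [Finset.mem_Icc]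
      refine ⟨Int.le_floor.2 (by push_cast; exact h2), ?_⟩
      have : (⌊(ω j - ω₀ j) / h⌋ : ℝ) ≤ m := (Int.floor_le _).trans h3
      exact_mod_cast this
    simp only [ht, hF, Finset.mem_product, Finset.mem_univ, true_and]
    exact ⟨hfl _, hfl _⟩
  have hfib : ∀ b ∈ t, (s.filter fun ω => F ω = b).card ≤ N := fun b _ => by
    rcases (s.filter fun ω => F ω = b).eq_empty_or_nonempty with he | ⟨y, hy⟩
    · rw [he]; simp
    obtain ⟨hys, hyb⟩ := Finset.mem_filter.1 hy
    have hy1 := 𝒦.norm_center l y (hs hys)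
    rw [← Set.ncard_coe_finset]
    refine le_trans (Set.ncard_le_ncard (fun ω hω => ?_) ?_) (hN l y)
    · obtain ⟨hωs, hωb⟩ := Finset.mem_filter.1 (Finset.mem_coe.1 hω)
      have hω1 := 𝒦.norm_center l ω (hs hωs)
      refine ⟨hs hωs, hy1, angle_le_of_norm_sub_le hω1 hy1 ?_⟩
      have hFe : F ω = F y := hωb.trans hyb.symm
      simp only [hF, Prod.mk.injEq] at hFe
      obtain ⟨g1, g2, g3, g4⟩ := hFe
      rw [g1] at g2 g3 g4
      have hclose : ∀ j, ⌊(ω j - ω₀ j) / h⌋ = ⌊(y j - ω₀ j) / h⌋ → |ω j - y j| ≤ h := fun j hj => by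
        have h1 := (Int.abs_sub_lt_one_of_floor_eq_floor hj).le
        rw [← sub_div, sub_sub_sub_cancel_right, abs_div, abs_of_pos h0, div_le_one h0] at h1
        exact h1
      have := norm_sub_le_of_coord_close hω1 hy1 (i y) (g1 ▸ hi ω hω1) (hi y hy1)
        (by simpa using g2) (hclose _ g3) (hclose _ g4)
      refine this.trans (le_of_eq ?_)
      rw [hh]; ring
    · exact (𝒦.centers l).finite_toSet.subset fun ω hω => hω.1
  have hcard := Finset.card_le_mul_card_image_of_maps_to hmaps N hfib
  have htc : t.card = 6 * (2 * m + 1) ^ 2 := by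
    simp only [ht, Finset.card_product, Finset.card_univ, Fintype.card_fin, Fintype.card_bool,
      Int.card_Icc]
    have : ((m : ℤ) + 1 - -(m : ℤ)).toNat = 2 * m + 1 := by omega
    rw [this]
    ring
  rw [htc] at hcard
  have hR0 : 0 ≤ R * 2 ^ l := by positivity
  calc (s.card : ℝ) ≤ N * (6 * (2 * m + 1) ^ 2) := by exact_mod_cast hcard
    _ ≤ N * (6 * (40 * (R * 2 ^ l + 1)) ^ 2) := by
        gcongr
        linarith
    _ = 9600 * N * (R * 2 ^ l + 1) ^ 2 := by ring
    _ ≤ _ := by gcongr; linarith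

lemma norm_sub_normalize_le {r : ℝ} (hr : 0 ≤ r) {ω ξ : E3} (hω : ‖ω‖ = 1) (hξ : ξ ≠ 0)
    (h : ξ ∈ cone r ω) : ‖ω - ‖ξ‖⁻¹ • ξ‖ ≤ r := by
  have hξ0 : 0 < ‖ξ‖ := norm_pos_iff.2 hξ
  have h1 : ‖ξ‖ - inner ℝ ω ξ ≤ ‖ξ‖ * (r ^ 2 / 2) := h
  refine abs_le_of_sq_le_sq' ?_ hr |>.2
  rw [norm_sub_sq_real, hω, inner_smul_right, norm_smul, norm_inv, norm_norm,
    inv_mul_cancel₀ hξ0.ne']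
  have h2 : 1 - ‖ξ‖⁻¹ * inner ℝ ω ξ ≤ r ^ 2 / 2 := by
    have : 1 - ‖ξ‖⁻¹ * inner ℝ ω ξ = ‖ξ‖⁻¹ * (‖ξ‖ - inner ℝ ω ξ) := by field_simp
    rw [this, inv_mul_le_iff₀ hξ0]
    exact h1
  linarith

/-! ### The angular projections -/

section Proj

variable (𝒦 : AngularDecomposition)

lemma measurable_etaTilde {l : ℕ} {ω : E3} (hω : ω ∈ 𝒦.centers l) :
    Measurable (𝒦.etaTilde l ω) :=
  measurable_of_continuousOn_compl_singleton 0 (𝒦.etaTilde_cutoff l ω hω).contDiffOn.continuousOn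

lemma abs_etaTilde_le {l : ℕ} {ω : E3} (hω : ω ∈ 𝒦.centers l) {ξ : E3} (hξ : ξ ≠ 0) :
    |𝒦.etaTilde l ω ξ| ≤ 𝒦.C 0 := by
  have h := (𝒦.etaTilde_cutoff l ω hω).deriv_bound 0 ξ hξ
  simpa [norm_iteratedFDeriv_zero] using h

lemma memLp_proj {l : ℕ} {ω : E3} (hω : ω ∈ 𝒦.centers l) (f : L2) :
    MemLp (fun v : E3 => ((𝒦.etaTilde l ω ((2 * Real.pi) • v) : ℝ) : ℂ) * (𝓕 f : L2) v) 2 volume := by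
  refine MemLp.of_le_mul (c := 𝒦.C 0) (Lp.memLp (𝓕 f : L2)) ?_ ?_
  · exact (Complex.measurable_ofReal.comp ((measurable_etaTilde 𝒦 hω).comp
      (measurable_const_smul _))).aestronglyMeasurable.mul (Lp.aestronglyMeasurable (𝓕 f : L2))
  · have : ∀ᵐ v : E3, v ≠ 0 := compl_mem_ae_iff.2 (measure_singleton 0)
    filter_upwards [this] with v hv
    rw [norm_mul, Complex.norm_real]
    gcongr
    exact abs_etaTilde_le 𝒦 hω (smul_ne_zero (by positivity) hv)

lemma hat_proj {l : ℕ} {ω : E3} (hω : ω ∈ 𝒦.centers l) (f : L2) :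
    ∀ᵐ ξ : E3, hat (𝒦.proj l ω f) ξ = (𝒦.etaTilde l ω ξ : ℂ) * hat f ξ := by
  have h2 : (2 * Real.pi) ≠ 0 := by positivity
  have hm := memLp_proj 𝒦 hω f
  have e : (𝓕 (𝒦.proj l ω f) : L2) = hm.toLp _ := by
    rw [AngularDecomposition.proj, multiplier, dif_pos hm, FourierTransform.fourier_fourierInv_eq]
  have hqm : Measure.QuasiMeasurePreserving (fun v : E3 => (2 * Real.pi)⁻¹ • v) volume volume := by
    refine ⟨measurable_const_smul _, ?_⟩
    rw [Measure.map_addHaar_smul _ (inv_ne_zero h2)]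
    exact Measure.smul_absolutelyContinuous
  filter_upwards [hqm.ae hm.coeFn_toLp] with ξ hξ
  rw [hat, e, hξ, smul_inv_smul₀ h2, hat]

lemma proj_support {k l : ℕ} {ω : E3} (hω : ω ∈ 𝒦.centers l) {f : L2} {S : Set E3}
    (hf : FourierSupportedIn f (shell k ∩ S)) :
    FourierSupportedIn (𝒦.proj l ω f) (shell k ∩ S ∩ cone (𝒦.M * ((2 : ℝ) ^ l)⁻¹ / 2) ω) := by
  filter_upwards [hat_proj 𝒦 hω f, hf] with ξ h1 h2 h3
  rw [h1]
  by_cases hS : ξ ∈ shell k ∩ S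
  · have h0 : 𝒦.etaTilde l ω ξ = 0 := by
      by_contra hne
      exact h3 ⟨hS, etaTilde_support 𝒦 hω (ne_zero_of_mem_shell hS.1) hne⟩
    rw [h0, Complex.ofReal_zero, zero_mul]
  · rw [h2 hS, mul_zero]

lemma eq_zero_of_fourierSupportedIn_empty {f : L2} (hf : FourierSupportedIn f ∅) : f = 0 := by
  have h1 : ∫ ξ, ‖hat f ξ‖ ^ 2 = 0 := by
    refine integral_eq_zero_of_ae ?_
    filter_upwards [hf] with ξ hξ
    rw [hξ (Set.notMem_empty ξ)]
    simp
  rw [integral_norm_hat_sq] at h1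
  have h2 : ‖f‖ ^ 2 = 0 := by
    have : (2 * Real.pi) ^ 3 ≠ 0 := by positivity
    exact (mul_eq_zero.1 h1).resolve_left this
  exact norm_eq_zero.1 (pow_eq_zero_iff two_ne_zero |>.1 h2)

/-- Almost orthogonality: finitely many of the symbols overlap at each frequency. -/
lemma exists_sum_norm_proj_sq_le : ∃ D : ℝ, 0 < D ∧ ∀ (l : ℕ) (f : L2),
    ∑ ω ∈ 𝒦.centers l, ‖𝒦.proj l ω f‖ ^ 2 ≤ D * ‖f‖ ^ 2 := by
  classical
  obtain ⟨K, hK, hcard⟩ := exists_card_centers_le 𝒦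
  have hM : 0 ≤ 𝒦.M := by linarith [𝒦.two_le_M]
  refine ⟨K * (𝒦.M / 2 + 1) ^ 2 * 𝒦.C 0 ^ 2 + 1, by positivity, fun l f => ?_⟩
  set D := K * (𝒦.M / 2 + 1) ^ 2 * 𝒦.C 0 ^ 2 with hD
  have hpt : ∀ ξ : E3, ξ ≠ 0 → ∑ ω ∈ 𝒦.centers l, 𝒦.etaTilde l ω ξ ^ 2 ≤ D := fun ξ hξ => by
    set r := 𝒦.M * ((2 : ℝ) ^ l)⁻¹ / 2 with hr
    have hr0 : 0 ≤ r := by positivity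
    have h1 := hcard l (‖ξ‖⁻¹ • ξ) r hr0 ((𝒦.centers l).filter fun ω => 𝒦.etaTilde l ω ξ ≠ 0)
      (Finset.filter_subset _ _) (fun ω hω => by
        obtain ⟨hω1, hω2⟩ := Finset.mem_filter.1 hω
        exact norm_sub_normalize_le hr0 (𝒦.norm_center l ω hω1) hξ (etaTilde_support 𝒦 hω1 hξ hω2))
    have h2 : r * 2 ^ l = 𝒦.M / 2 := by rw [hr]; field_simp
    rw [h2] at h1
    calc ∑ ω ∈ 𝒦.centers l, 𝒦.etaTilde l ω ξ ^ 2
        = ∑ ω ∈ (𝒦.centers l).filter fun ω => 𝒦.etaTilde l ω ξ ≠ 0, 𝒦.etaTilde l ω ξ ^ 2 := by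
          rw [Finset.sum_filter_of_ne]
          intro ω _ hne h0
          exact hne (by rw [h0]; simp)
      _ ≤ ∑ ω ∈ (𝒦.centers l).filter fun ω => 𝒦.etaTilde l ω ξ ≠ 0, 𝒦.C 0 ^ 2 := by
          refine Finset.sum_le_sum fun ω hω => ?_
          rw [← sq_abs]
          gcongr
          exact abs_etaTilde_le 𝒦 (Finset.mem_filter.1 hω).1 hξ
      _ ≤ D := by
          rw [Finset.sum_const, nsmul_eq_mul, hD]
          gcongr
  have hsum : (2 * Real.pi) ^ 3 * ∑ ω ∈ 𝒦.centers l, ‖𝒦.proj l ω f‖ ^ 2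
      ≤ (2 * Real.pi) ^ 3 * (D * ‖f‖ ^ 2) := by
    calc (2 * Real.pi) ^ 3 * ∑ ω ∈ 𝒦.centers l, ‖𝒦.proj l ω f‖ ^ 2
        = ∑ ω ∈ 𝒦.centers l, ∫ ξ, ‖hat (𝒦.proj l ω f) ξ‖ ^ 2 := by
          rw [Finset.mul_sum]
          exact Finset.sum_congr rfl fun ω _ => (integral_norm_hat_sq _).symm
      _ = ∫ ξ, ∑ ω ∈ 𝒦.centers l, ‖hat (𝒦.proj l ω f) ξ‖ ^ 2 :=
          (integral_finsetSum _ fun ω _ => integrable_norm_hat_sq _).symm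
      _ ≤ ∫ ξ, D * ‖hat f ξ‖ ^ 2 := by
          refine integral_mono_ae (integrable_finsetSum _ fun ω _ => integrable_norm_hat_sq _)
            ((integrable_norm_hat_sq f).const_mul D) ?_
          have hne : ∀ᵐ v : E3, v ≠ 0 := compl_mem_ae_iff.2 (measure_singleton 0)
          have hall : ∀ᵐ ξ : E3, ∀ ω ∈ 𝒦.centers l,
              hat (𝒦.proj l ω f) ξ = (𝒦.etaTilde l ω ξ : ℂ) * hat f ξ :=
            (ae_ball_iff (𝒦.centers l).countable_toSet).2 fun ω hω => hat_proj 𝒦 hω f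
          filter_upwards [hne, hall] with ξ h0 h1
          calc ∑ ω ∈ 𝒦.centers l, ‖hat (𝒦.proj l ω f) ξ‖ ^ 2
              = (∑ ω ∈ 𝒦.centers l, 𝒦.etaTilde l ω ξ ^ 2) * ‖hat f ξ‖ ^ 2 := by
                rw [Finset.sum_mul]
                refine Finset.sum_congr rfl fun ω hω => ?_
                rw [h1 ω hω, norm_mul, Complex.norm_real, mul_pow, Real.norm_eq_abs, sq_abs]
            _ ≤ D * ‖hat f ξ‖ ^ 2 := by
                gcongr
                exact hpt ξ h0
      _ = _ := by rw [integral_const_mul, integral_norm_hat_sq]; ring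
  have h3 := le_of_mul_le_mul_left hsum (by positivity)
  nlinarith [sq_nonneg ‖f‖]

/-- Only `O(4^{k-l})` of the caps of `𝒦_k` meet a given sector of `𝒦_l`, so that the `ℓ¹` sum costs
a factor `2^{k-l}` by the Cauchy–Schwarz inequality. -/
lemma exists_sum_norm_proj_le : ∃ D : ℝ, 0 < D ∧ ∀ (k l : ℕ), l ≤ k → ∀ ω₁ : E3, ‖ω₁‖ = 1 →
    ∀ f : L2, FourierSupportedIn f (shell k ∩ cone (𝒦.M * ((2 : ℝ) ^ l)⁻¹ / 2) ω₁) →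
      ∑ ω ∈ 𝒦.centers k, ‖𝒦.proj k ω f‖ ≤ D * 2 ^ (k - l) * ‖f‖ := by
  classical
  obtain ⟨K, hK, hcard⟩ := exists_card_centers_le 𝒦
  obtain ⟨D, hD, hsq⟩ := exists_sum_norm_proj_sq_le 𝒦
  have hM : 0 ≤ 𝒦.M := by linarith [𝒦.two_le_M]
  refine ⟨Real.sqrt (K * (𝒦.M + 1) ^ 2 * D), Real.sqrt_pos.2 (by positivity),
    fun k l hlk ω₁ hω₁ f hf => ?_⟩
  set s := (𝒦.centers k).filter fun ω => 𝒦.proj k ω f ≠ 0 with hs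
  have hpow : (2 : ℝ) ^ k = 2 ^ l * 2 ^ (k - l) := by rw [← pow_add]; congr 1; omega
  have hone : (1 : ℝ) ≤ 2 ^ (k - l) := one_le_pow₀ (by norm_num)
  have hscard : (s.card : ℝ) ≤ K * (𝒦.M + 1) ^ 2 * (2 ^ (k - l)) ^ 2 := by
    have h1 := hcard k ω₁ (𝒦.M * ((2 : ℝ) ^ l)⁻¹) (by positivity) s (Finset.filter_subset _ _)
      (fun ω hω => by
        obtain ⟨hωk, hne⟩ := Finset.mem_filter.1 hω
        -- the supports meet, since the projection does not vanish
        obtain ⟨ξ, hξ⟩ : (shell k ∩ cone (𝒦.M * ((2 : ℝ) ^ l)⁻¹ / 2) ω₁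
            ∩ cone (𝒦.M * ((2 : ℝ) ^ k)⁻¹ / 2) ω).Nonempty := by
          rw [Set.nonempty_iff_ne_empty]
          intro he
          have := proj_support 𝒦 hωk hf
          rw [he] at this
          exact hne (eq_zero_of_fourierSupportedIn_empty this)
        have hξ0 := ne_zero_of_mem_shell hξ.1.1
        have a1 := norm_sub_normalize_le (by positivity) hω₁ hξ0 hξ.1.2
        have a2 := norm_sub_normalize_le (by positivity) (𝒦.norm_center k ω hωk) hξ0 hξ.2
        have a3 : 𝒦.M * ((2 : ℝ) ^ k)⁻¹ / 2 ≤ 𝒦.M * ((2 : ℝ) ^ l)⁻¹ / 2 := by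
          gcongr
          norm_num
        rw [← norm_neg, neg_sub] at a1
        calc ‖ω - ω₁‖ = ‖(ω - ‖ξ‖⁻¹ • ξ) + (‖ξ‖⁻¹ • ξ - ω₁)‖ := by rw [sub_add_sub_cancel]
          _ ≤ ‖ω - ‖ξ‖⁻¹ • ξ‖ + ‖‖ξ‖⁻¹ • ξ - ω₁‖ := norm_add_le _ _
          _ ≤ 𝒦.M * ((2 : ℝ) ^ l)⁻¹ := by linarith)
    refine h1.trans ?_
    rw [mul_assoc K, ← mul_pow, hpow]
    have e : 𝒦.M * ((2 : ℝ) ^ l)⁻¹ * (2 ^ l * 2 ^ (k - l)) = 𝒦.M * 2 ^ (k - l) := by field_simp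
    rw [e]
    gcongr
    linarith
  have hsum : ∑ ω ∈ 𝒦.centers k, ‖𝒦.proj k ω f‖ = ∑ ω ∈ s, ‖𝒦.proj k ω f‖ := by
    rw [hs, Finset.sum_filter_of_ne]
    intro ω _ hne h0
    exact hne (by rw [h0, norm_zero])
  have hsub : ∑ ω ∈ s, ‖𝒦.proj k ω f‖ ^ 2 ≤ D * ‖f‖ ^ 2 :=
    (Finset.sum_le_sum_of_subset_of_nonneg (Finset.filter_subset _ _)
      fun _ _ _ => sq_nonneg _).trans (hsq k f)
  rw [hsum]
  refine abs_le_of_sq_le_sq' ?_ (by positivity) |>.2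
  calc (∑ ω ∈ s, ‖𝒦.proj k ω f‖) ^ 2 ≤ s.card * ∑ ω ∈ s, ‖𝒦.proj k ω f‖ ^ 2 :=
        sq_sum_le_card_mul_sum_sq
    _ ≤ (K * (𝒦.M + 1) ^ 2 * (2 ^ (k - l)) ^ 2) * (D * ‖f‖ ^ 2) := by
        gcongr
    _ = _ := by
        rw [mul_pow, mul_pow, Real.sq_sqrt (by positivity)]
        ring

end Proj

end KleinGordon

theorem mainTheorem3 (ρ : ℝ → ℝ) (hρ : IsCutoff ρ) (𝒦 : AngularDecomposition) :
    -- i) low frequencies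
    (∀ k₀ : ℤ, ∃ C : ℝ≥0, ∀ k : ℤ, k ≤ k₀ → ∀ f : L2, FourierSupportedIn f (annulus ρ k) →
      mixedNorm 2 ⊤ (freeWave f) ≤ C * (2 : ℝ≥0∞) ^ ((k : ℝ) / 2) * ‖f‖ₑ) ∧
    -- ii) high frequencies, localized to one cap of `𝒦_k`
    (∃ C : ℝ≥0, ∀ k : ℕ, 1 ≤ k → ∀ ω ∈ 𝒦.centers k,
      ∀ b : OrthonormalBasis (Fin 3) ℝ E3, b 0 = ω →
      ∀ f : L2, FourierSupportedIn f (𝒦.sector ρ k k ω) →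
        ((2 : ℝ≥0∞) ^ k)⁻¹ * mixedNorm 2 ⊤ (freeWave f) + frameNorm 2 ⊤ (lamK k) b (freeWave f)
          ≤ C * ‖f‖ₑ) ∧
    -- iii) the `ℓ¹` sum over the caps of `𝒦_k`, for data localized to one cap of `𝒦_l`
    (∃ C : ℝ≥0, ∀ k l : ℕ, 1 ≤ k → 1 ≤ l → l ≤ k → ∀ ω₁ ∈ 𝒦.centers l,
      ∀ b : E3 → OrthonormalBasis (Fin 3) ℝ E3, (∀ ω ∈ 𝒦.centers k, b ω 0 = ω) →
      ∀ f : L2, FourierSupportedIn f (𝒦.sector ρ k l ω₁) →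
        ∑ ω ∈ 𝒦.centers k, frameNorm 2 ⊤ (lamK k) (b ω) (freeWave (𝒦.proj k ω f))
          ≤ C * (2 : ℝ≥0∞) ^ (k - l) * ‖f‖ₑ) := by
  refine ⟨fun k₀ => ?_, ?_, ?_⟩
  · obtain ⟨C, hC⟩ := low_frequency k₀
    exact ⟨C, fun k hk f hf => hC k hk f (hf.mono (annulus_subset_shell hρ k))⟩
  · obtain ⟨C, hC⟩ := sector_estimates 𝒦.M
    refine ⟨C + C, fun k _ ω hω b hb f hf => ?_⟩
    subst hb
    obtain ⟨h1, h2⟩ := hC k b f (hf.mono (sector_subset 𝒦 hρ k hω))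
    rw [ENNReal.coe_add, add_mul]
    refine add_le_add ?_ h2
    calc ((2 : ℝ≥0∞) ^ k)⁻¹ * mixedNorm 2 ⊤ (freeWave f)
        ≤ ((2 : ℝ≥0∞) ^ k)⁻¹ * (C * (2 : ℝ≥0∞) ^ k * ‖f‖ₑ) := by gcongr
      _ = (((2 : ℝ≥0∞) ^ k)⁻¹ * (2 : ℝ≥0∞) ^ k) * (C * ‖f‖ₑ) := by ring
      _ = C * ‖f‖ₑ := by
          rw [ENNReal.inv_mul_cancel (by positivity) (by finiteness), one_mul]
  · obtain ⟨C, hC⟩ := sector_estimates 𝒦.M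
    obtain ⟨D, hD, hsum⟩ := exists_sum_norm_proj_le 𝒦
    refine ⟨C * Real.toNNReal D, fun k l _ _ hlk ω₁ hω₁ b hb f hf => ?_⟩
    have hf' := hf.mono (sector_subset 𝒦 hρ k hω₁)
    have h1 : ∀ ω ∈ 𝒦.centers k, frameNorm 2 ⊤ (lamK k) (b ω) (freeWave (𝒦.proj k ω f))
        ≤ C * ENNReal.ofReal ‖𝒦.proj k ω f‖ := fun ω hω => by
      rw [ofReal_norm]
      refine (hC k (b ω) _ ?_).2
      rw [hb ω hω]
      exact (proj_support 𝒦 hω hf').mono fun ξ hξ => ⟨hξ.1.1, hξ.2⟩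
    refine (Finset.sum_le_sum h1).trans ?_
    rw [← Finset.mul_sum, ← ENNReal.ofReal_sum_of_nonneg fun _ _ => norm_nonneg _, ENNReal.coe_mul,
      mul_assoc, mul_assoc]
    gcongr
    refine (ENNReal.ofReal_le_ofReal (hsum k l hlk ω₁ (𝒦.norm_center l ω₁ hω₁) f hf')).trans_eq ?_
    rw [mul_assoc, ENNReal.ofReal_mul hD.le, ENNReal.ofReal_mul (by positivity),
      ENNReal.ofReal_pow two_pos.le, ENNReal.ofReal_ofNat, ofReal_norm]
    rfl
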